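/- Let $n\ge 2$, let $\omega\subset\mathbb{R}^{n-1}$ be a bounded domain with $C^1$ boundary, and let $h_\pm\in C(\overline\omega)\cap C^1(\omega)$ be such that $H:=h_-+h_+$ satisfies $H>0$ in $\omega$ and $H=0$ on $\partial\omega$. Put $d:=h_+-h_-$, $p:=h_+h_-$ and, for $\varepsilon>0$, $$\Omega_\varepsilon:=\{(x',x_n)\in\mathbb{R}^{n-1}\times\mathbb{R}:\ x'\in\omega,\ -\varepsilon h_-(x')<x_n<\varepsilon h_+(x')\},$$ and let $u_\varepsilon\in C^2(\Omega_\varepsilon)\cap C(\overline{\Omega_\varepsilon})$ be the solution of $$-\Delta u_\varepsilon=2\ \text{ in }\Omega_\varepsilon,\qquad u_\varepsilon=0\ \text{ on }\partial\Omega_\varepsilon .$$ Assume that (H1) there is a unique point $\overline{x}\in\omega$ at which $H$ attains its global maximum, denoted by $H_0$; (H2) the Hessian matrix of $H$ at $\overline{x}$, denoted by $2H_2$, is negative definite; (H3) $h_+$ and $h_-$ are five times continuously differentiable in a neighbourhood of $\overline{x}$. Let $d_0:=d(\overline{x})$, and let $2D_2$ and $2P_2$ be the Hessian matrices at $\overline{x}$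 of $d$ and $p$, respectively. Then, for all sufficiently small $\varepsilon>0$, $u_\varepsilon$ attains its maximum over $\Omega_\varepsilon$, and $$\max_{x\in\Omega_\varepsilon}u_\varepsilon(x)=\frac14H_0^2\varepsilon^2+\frac18H_0^2\left[d_0\operatorname{tr}D_2+2\operatorname{tr}P_2\right]\varepsilon^4+\mathcal{O}(\varepsilon^5)\qquad\text{as }\varepsilon\to0^+ .$$ -/

import Mathlib

namespace ThinDomain

noncomputable section

/-- The base variable `x' = (x₁, …, xₘ)` of a point `x = (x', xₙ)` of `ℝⁿ`, where `n = m + 1`. -/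
def base {m : ℕ} (x : EuclideanSpace ℝ (Fin (m + 1))) : EuclideanSpace ℝ (Fin m) :=
  WithLp.toLp 2 (fun i : Fin m => x i.castSucc)

/-- The last coordinate `xₙ` of a point `x = (x', xₙ)` of `ℝⁿ`, where `n = m + 1`. -/
def height {m : ℕ} (x : EuclideanSpace ℝ (Fin (m + 1))) : ℝ :=
  x (Fin.last m)

/-- The open set `ω` has a `C¹` boundary: near each of its boundary points, `ω` is the sublevel set
`{φ < 0}` of a `C¹` function `φ` whose derivative does not vanish at that point (by the implicit
function theorem: locally, `ω` is the region on one side of the graph of a `C¹` function). -/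
def HasC1Boundary {m : ℕ} (ω : Set (EuclideanSpace ℝ (Fin m))) : Prop :=
  ∀ y ∈ frontier ω, ∃ (U : Set (EuclideanSpace ℝ (Fin m))) (φ : EuclideanSpace ℝ (Fin m) → ℝ),
    IsOpen U ∧ y ∈ U ∧ ContDiffOn ℝ 1 φ U ∧ fderiv ℝ φ y ≠ 0 ∧
      ∀ x ∈ U, (x ∈ ω ↔ φ x < 0)

/-- The thin domain `Ω_ε = {(x', xₙ) : x' ∈ ω, -ε h₋(x') < xₙ < ε h₊(x')}`. -/
def thinDomain {m : ℕ} (ω : Set (EuclideanSpace ℝ (Fin m)))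
    (hMinus hPlus : EuclideanSpace ℝ (Fin m) → ℝ) (ε : ℝ) :
    Set (EuclideanSpace ℝ (Fin (m + 1))) :=
  {x | base x ∈ ω ∧ -(ε * hMinus (base x)) < height x ∧ height x < ε * hPlus (base x)}

/-- `u` is a classical solution, continuous up to the boundary, of the problem
`-Δu = 2` in the open set `Ω`, `u = 0` on `∂Ω`. -/
structure IsTorsionFunction {n : ℕ} (Ω : Set (EuclideanSpace ℝ (Fin n)))
    (u : EuclideanSpace ℝ (Fin n) → ℝ) : Prop where
  contDiffOn : ContDiffOn ℝ 2 u Ω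
  continuousOn : ContinuousOn u (closure Ω)
  neg_laplacian : ∀ x ∈ Ω, -(Laplacian.laplacian u x) = 2
  boundary : ∀ x ∈ frontier Ω, u x = 0

/-- The Hessian matrix `(∂ᵢ∂ⱼ f (x))` of a real function `f`. -/
def hessian {m : ℕ} (f : EuclideanSpace ℝ (Fin m) → ℝ) (x : EuclideanSpace ℝ (Fin m)) :
    Matrix (Fin m) (Fin m) ℝ :=
  Matrix.of fun i j =>
    fderiv ℝ (fun y => fderiv ℝ f y (EuclideanSpace.single j 1)) x (EuclideanSpace.single i 1)

end

end ThinDomain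

open Laplacian

namespace ThinDomain

/-! ### Second derivatives along lines and the Laplacian -/

section Calculus

variable {E : Type*} [NormedAddCommGroup E] [NormedSpace ℝ E]

/-! Across a thin domain the second derivative in the last variable `z` dominates, so to leading
order the solution is the parabola `(ε h₊ - z)(z + ε h₋) = ε² p + ε d z - z²`, whose maximum over
each fibre is `ε² H² / 4`. Multiplying it by `1 + ε² β + ε α z` keeps the zero values on top and
bottom. With `α = Δd / 6` and `β = Δp / 2 + d α` the Laplacian becomes `-2 + O(ε⁴)`
(`laplacian_profile`).

The error of this profile is controlled locally. The harmonic barrier `∑ cosh(κ (yᵢ - x₀ᵢ)) cos(κ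
z)`, with `κ` of order `1 / ε`, shows that lateral data at a fixed distance from the axis are damped
by at least a factor of order `ε⁴` (`le_on_axis_of_laplacian_ge`). The lateral data are `O(ε²)`, and
an `O(ε⁴)` source in height `O(ε)` contributes `O(ε⁶)`. Hence the error is `O(ε⁶)` near the maximum
point (`exists_abs_sub_profile_le`).

Elsewhere `H` stays below `H₀` by a fixed gap. Comparison with a slab, localised by the same
barrier, then keeps the solution below the maximum at order `ε²` (`exists_torsion_le_of_le_sub`).

It remains to maximise the profile. Nondegeneracy makes its main factor decay quadratically in the
horizontal distance and in the offset from the fibre's midpoint, while the corrections vary at most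
linearly. Completing squares costs only `O(ε⁶)` (`mul_one_add_le_of_quadratic_decay`). So the
maximum agrees up to `O(ε⁶)` with the profile at the midpoint of the fibre over `xbar`, namely `ε²
H₀² / 4 * (1 + ε² (Δp / 2 + d Δd / 4))`. -/

theorem hasDerivAt_comp_line {f : E → ℝ} {x e : E} {s : ℝ}
    (hf : DifferentiableAt ℝ f (x + s • e)) :
    HasDerivAt (fun t : ℝ => f (x + t • e)) (fderiv ℝ f (x + s • e) e) s := by
  have h1 : HasDerivAt (fun t : ℝ => x + t • e) e s := by
    simpa using ((hasDerivAt_id s).smul_const e).const_add x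
  exact hf.hasFDerivAt.comp_hasDerivAt s h1

theorem hasDerivAt_fderiv_comp_line {f : E → ℝ} {x e : E} {s : ℝ}
    (hf : ContDiffAt ℝ 2 f (x + s • e)) :
    HasDerivAt (fun t : ℝ => fderiv ℝ f (x + t • e) e)
      (fderiv ℝ (fderiv ℝ f) (x + s • e) e e) s := by
  have h1 : HasDerivAt (fun t : ℝ => x + t • e) e s := by
    simpa using ((hasDerivAt_id s).smul_const e).const_add x
  have h2 : DifferentiableAt ℝ (fderiv ℝ f) (x + s • e) :=
    (hf.fderiv_right (m := 1) (by norm_num)).differentiableAt (by norm_num)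
  have h3 := h2.hasFDerivAt.comp_hasDerivAt s h1
  exact h3.clm_apply (hasDerivAt_const s e) |>.congr_deriv (by simp)

/-- Reduces each diagonal term of the Laplacian to calculus in one variable. -/
theorem deriv_deriv_line {f : E → ℝ} {x e : E} (hf : ContDiffAt ℝ 2 f x) :
    deriv (deriv fun t : ℝ => f (x + t • e)) 0 = fderiv ℝ (fderiv ℝ f) x e e := by
  have hc : Filter.Tendsto (fun t : ℝ => x + t • e) (nhds 0) (nhds x) := by
    have : Continuous fun t : ℝ => x + t • e := by fun_prop
    simpa using this.tendsto 0
  have h1 : ∀ᶠ t in nhds (0 : ℝ), deriv (fun t : ℝ => f (x + t • e)) t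
      = fderiv ℝ f (x + t • e) e := by
    have h2 : ∀ᶠ y in nhds x, ContDiffAt ℝ 2 f y := hf.eventually (by simp)
    filter_upwards [hc.eventually h2] with t ht
    exact (hasDerivAt_comp_line (ht.differentiableAt (by norm_num))).deriv
  rw [Filter.EventuallyEq.deriv_eq h1]
  have h3 := hasDerivAt_fderiv_comp_line (f := f) (x := x) (e := e) (s := 0) (by simpa using hf)
  simpa using h3.deriv

/-- A positive second derivative along a line would make the point a local minimum of the
restriction as well. The restriction would then be locally constant, with zero second derivative. -/
theorem fderiv_fderiv_nonpos_of_isLocalMax {f : E → ℝ} {x : E} (hf : ContDiffAt ℝ 2 f x)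
    (hmax : IsLocalMax f x) (e : E) : fderiv ℝ (fderiv ℝ f) x e e ≤ 0 := by
  by_contra! hpos
  rw [← deriv_deriv_line hf] at hpos
  have hcont : Continuous fun t : ℝ => x + t • e := by fun_prop
  have hc : Filter.Tendsto (fun t : ℝ => x + t • e) (nhds 0) (nhds x) := by
    simpa using hcont.tendsto 0
  set φ : ℝ → ℝ := fun t => f (x + t • e) with hφ
  have hmax' : IsLocalMax φ 0 := by
    have := hc.eventually hmax
    simpa [IsLocalMax, IsMaxFilter, hφ] using this
  have hφc : ContinuousAt φ 0 := by
    have h : ContinuousAt f (x + (0 : ℝ) • e) := by simpa using hf.continuousAt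
    exact ContinuousAt.comp (f := fun t : ℝ => x + t • e) h hcont.continuousAt
  have hmin := isLocalMin_of_deriv_deriv_pos hpos hmax'.deriv_eq_zero hφc
  have hconst : φ =ᶠ[nhds 0] fun _ => φ 0 := by
    filter_upwards [hmin, hmax'] with t h1 h2
    exact le_antisymm h2 h1
  have h4 : deriv (deriv φ) 0 = 0 := by
    rw [(hconst.deriv).deriv_eq]
    simp
  linarith

end Calculus

theorem laplacian_eq_sum {n : ℕ} (f : EuclideanSpace ℝ (Fin n) → ℝ)
    (x : EuclideanSpace ℝ (Fin n)) :
    Δ f x = ∑ i, fderiv ℝ (fderiv ℝ f) x (EuclideanSpace.single i 1)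
      (EuclideanSpace.single i 1) := by
  rw [InnerProductSpace.laplacian_eq_iteratedFDeriv_orthonormalBasis f
    (EuclideanSpace.basisFun (Fin n) ℝ)]
  simp [iteratedFDeriv_two_apply]

theorem contDiffOn_laplacian {n : ℕ} {f : EuclideanSpace ℝ (Fin n) → ℝ}
    {s : Set (EuclideanSpace ℝ (Fin n))} (hs : IsOpen s) {k l : WithTop ℕ∞}
    (hf : ContDiffOn ℝ k f s) (hkl : l + 1 + 1 ≤ k) :
    ContDiffOn ℝ l (Δ f) s := by
  have h1 : ContDiffOn ℝ l (fderiv ℝ (fderiv ℝ f)) s :=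
    (hf.fderiv_of_isOpen hs hkl).fderiv_of_isOpen hs le_rfl
  have h2 : Δ f = fun x => ∑ i, fderiv ℝ (fderiv ℝ f) x (EuclideanSpace.single i 1)
      (EuclideanSpace.single i 1) := by
    funext x; exact laplacian_eq_sum f x
  rw [h2]
  refine ContDiffOn.sum fun i _ => ?_
  exact (h1.clm_apply contDiffOn_const).clm_apply contDiffOn_const

theorem hessian_apply {m : ℕ} {f : EuclideanSpace ℝ (Fin m) → ℝ} {x : EuclideanSpace ℝ (Fin m)}
    (hf : ContDiffAt ℝ 2 f x) (i j : Fin m) :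
    hessian f x i j = fderiv ℝ (fderiv ℝ f) x (EuclideanSpace.single i 1)
      (EuclideanSpace.single j 1) := by
  have h2 : DifferentiableAt ℝ (fderiv ℝ f) x :=
    (hf.fderiv_right (m := 1) (by norm_num)).differentiableAt (by norm_num)
  simp only [hessian, Matrix.of_apply]
  rw [fderiv_clm_apply h2 (differentiableAt_const _)]
  simp

theorem trace_hessian {m : ℕ} {f : EuclideanSpace ℝ (Fin m) → ℝ} {x : EuclideanSpace ℝ (Fin m)}
    (hf : ContDiffAt ℝ 2 f x) : (hessian f x).trace = Δ f x := by
  rw [laplacian_eq_sum, Matrix.trace]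
  exact Finset.sum_congr rfl fun i _ => hessian_apply hf i i

theorem laplacian_nonpos_of_isLocalMax {n : ℕ} {f : EuclideanSpace ℝ (Fin n) → ℝ}
    {x : EuclideanSpace ℝ (Fin n)} (hf : ContDiffAt ℝ 2 f x) (hmax : IsLocalMax f x) :
    Δ f x ≤ 0 := by
  rw [laplacian_eq_sum]
  exact Finset.sum_nonpos fun i _ => fderiv_fderiv_nonpos_of_isLocalMax hf hmax _

/-! ### Product functions -/

/-- The projection `base` as a continuous linear map. -/
noncomputable def baseL (m : ℕ) :
    EuclideanSpace ℝ (Fin (m + 1)) →L[ℝ] EuclideanSpace ℝ (Fin m) :=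
  LinearMap.toContinuousLinearMap
    { toFun := base
      map_add' := fun x y => by ext i; simp [base]
      map_smul' := fun c x => by ext i; simp [base] }

/-- The last coordinate as a continuous linear map. -/
noncomputable def heightL (m : ℕ) : EuclideanSpace ℝ (Fin (m + 1)) →L[ℝ] ℝ :=
  LinearMap.toContinuousLinearMap
    { toFun := height
      map_add' := fun x y => by simp [height]
      map_smul' := fun c x => by simp [height] }

theorem contDiff_base {m : ℕ} {k : WithTop ℕ∞} : ContDiff ℝ k (base (m := m)) :=
  (baseL m).contDiff

theorem contDiff_height {m : ℕ} {k : WithTop ℕ∞} : ContDiff ℝ k (height (m := m)) :=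
  (heightL m).contDiff

theorem continuous_base {m : ℕ} : Continuous (base (m := m)) := (baseL m).continuous

theorem continuous_height {m : ℕ} : Continuous (height (m := m)) := (heightL m).continuous

theorem contDiffAt_base_mul_height {m : ℕ} {g : EuclideanSpace ℝ (Fin m) → ℝ} {k : ℝ → ℝ}
    {x : EuclideanSpace ℝ (Fin (m + 1))} (hg : ContDiffAt ℝ 2 g (base x))
    (hk : ContDiffAt ℝ 2 k (height x)) :
    ContDiffAt ℝ 2 (fun y => g (base y) * k (height y)) x :=
  (hg.comp x contDiff_base.contDiffAt).mul (hk.comp x contDiff_height.contDiffAt)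

theorem base_add_smul_castSucc {m : ℕ} (x : EuclideanSpace ℝ (Fin (m + 1))) (i : Fin m) (t : ℝ) :
    base (x + t • EuclideanSpace.single i.castSucc 1) = base x + t • EuclideanSpace.single i 1 := by
  ext j
  simp [base]

theorem height_add_smul_castSucc {m : ℕ} (x : EuclideanSpace ℝ (Fin (m + 1))) (i : Fin m)
    (t : ℝ) : height (x + t • EuclideanSpace.single i.castSucc 1) = height x := by
  simp [height, Fin.ext_iff, i.2.ne']

theorem base_add_smul_last {m : ℕ} (x : EuclideanSpace ℝ (Fin (m + 1))) (t : ℝ) :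
    base (x + t • EuclideanSpace.single (Fin.last m) 1) = base x := by
  ext j
  simp [base, Fin.ext_iff, j.2.ne]

theorem height_add_smul_last {m : ℕ} (x : EuclideanSpace ℝ (Fin (m + 1))) (t : ℝ) :
    height (x + t • EuclideanSpace.single (Fin.last m) 1) = height x + t := by
  simp [height]

/-- The barrier, the comparison parabolas and the profile are all combinations of such products, so
this one formula yields all their Laplacians. -/
theorem laplacian_base_mul_height {m : ℕ} {g : EuclideanSpace ℝ (Fin m) → ℝ} {k : ℝ → ℝ}
    {x : EuclideanSpace ℝ (Fin (m + 1))} (hg : ContDiffAt ℝ 2 g (base x))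
    (hk : ContDiffAt ℝ 2 k (height x)) :
    Δ (fun y => g (base y) * k (height y)) x
      = Δ g (base x) * k (height x) + g (base x) * deriv (deriv k) (height x) := by
  have hf := contDiffAt_base_mul_height hg hk
  rw [laplacian_eq_sum, Fin.sum_univ_castSucc, laplacian_eq_sum, Finset.sum_mul]
  congr 1
  · refine Finset.sum_congr rfl fun i _ => ?_
    rw [← deriv_deriv_line hf, ← deriv_deriv_line hg]
    simp only [base_add_smul_castSucc, height_add_smul_castSucc]
    have h1 : (deriv fun t : ℝ => g (base x + t • EuclideanSpace.single i 1) * k (height x))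
        = fun s => deriv (fun t : ℝ => g (base x + t • EuclideanSpace.single i 1)) s
          * k (height x) := by
      funext s; exact deriv_mul_const_field _
    rw [h1, deriv_mul_const_field]
  · rw [← deriv_deriv_line hf]
    simp only [base_add_smul_last, height_add_smul_last]
    have h1 : (deriv fun t : ℝ => g (base x) * k (height x + t))
        = fun s => g (base x) * deriv k (height x + s) := by
      funext s
      rw [deriv_const_mul_field, deriv_comp_const_add]
    rw [h1, deriv_const_mul_field, deriv_comp_const_add (f := deriv k), add_zero]

/-! ### The maximum principle -/

/-- Weak maximum principle. Adding `δ * height²` makes the Laplacian strictly positive, which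
excludes an interior maximum. The perturbation is then made small. -/
theorem nonpos_of_laplacian_nonneg {m : ℕ} {U : Set (EuclideanSpace ℝ (Fin (m + 1)))}
    (hU : IsOpen U) (hUb : Bornology.IsBounded U) {w : EuclideanSpace ℝ (Fin (m + 1)) → ℝ}
    (hw : ContDiffOn ℝ 2 w U) (hwc : ContinuousOn w (closure U))
    (hΔ : ∀ x ∈ U, 0 ≤ Δ w x) (hbd : ∀ x ∈ closure U, x ∉ U → w x ≤ 0) :
    ∀ x ∈ closure U, w x ≤ 0 := by
  have hcomp : IsCompact (closure U) := hUb.isCompact_closure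
  obtain ⟨R, hR⟩ : ∃ R, ∀ x ∈ closure U, height x ^ 2 ≤ R := by
    obtain ⟨R, hR⟩ := (hcomp.image (f := fun x : EuclideanSpace ℝ (Fin (m + 1)) => height x ^ 2)
      (continuous_height.pow 2)).bddAbove
    exact ⟨R, fun x hx => hR ⟨x, hx, rfl⟩⟩
  intro x hx
  have key : ∀ δ > 0, w x ≤ δ * R := by
    intro δ hδ
    set q : EuclideanSpace ℝ (Fin (m + 1)) → ℝ := fun y => (δ : ℝ) * height y ^ 2 with hq
    obtain ⟨z, hz, hzmax⟩ := hcomp.exists_isMaxOn ⟨x, hx⟩ (f := w + q)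
      (hwc.add (continuous_const.mul (continuous_height.pow 2)).continuousOn)
    have hxz : w x + q x ≤ w z + q z := hzmax hx
    have hqx : 0 ≤ q x := by positivity
    have hqz : q z ≤ δ * R := mul_le_mul_of_nonneg_left (hR z hz) hδ.le
    by_cases hzU : z ∈ U
    · exfalso
      have hloc : IsLocalMax (w + q) z := by
        filter_upwards [hU.mem_nhds hzU] with y hy
        exact hzmax (subset_closure hy)
      have hwz : ContDiffAt ℝ 2 w z := hw.contDiffAt (hU.mem_nhds hzU)
      have hk : ContDiffAt ℝ 2 (fun t : ℝ => t ^ 2) (height z) := by fun_prop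
      have hqd : ContDiffAt ℝ 2 q z :=
        contDiffAt_base_mul_height (g := fun _ => δ) contDiffAt_const hk
      have h1 : Δ (w + q) z ≤ 0 := laplacian_nonpos_of_isLocalMax (hwz.add hqd) hloc
      rw [hwz.laplacian_add hqd] at h1
      have h2 : Δ q z = 2 * δ := by
        rw [hq, laplacian_base_mul_height (g := fun _ => δ) contDiffAt_const hk]
        have : deriv (deriv fun t : ℝ => t ^ 2) = fun _ => 2 := by
          have : (deriv fun t : ℝ => t ^ 2) = fun t => 2 * t := by funext t; simp
          rw [this]; funext t; simp
        rw [this]; simp; ring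
      have := hΔ z hzU
      linarith
    · have := hbd z hz hzU
      linarith
  have hR0 : 0 ≤ R := (sq_nonneg _).trans (hR x hx)
  by_contra! hpos
  -- This `δ` makes `δ * R` smaller than `w x`; the `+ 1` covers `R = 0`.
  have := key (w x / (2 * (R + 1))) (by positivity)
  have h2 : w x / (2 * (R + 1)) * R < w x := by
    rw [div_mul_eq_mul_div, div_lt_iff₀ (by positivity)]
    nlinarith
  linarith

/-! ### Linearity of the Laplacian and functions of a single coordinate -/

section LaplacianAlgebra

variable {n : ℕ} {f g : EuclideanSpace ℝ (Fin n) → ℝ} {x : EuclideanSpace ℝ (Fin n)}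

theorem laplacian_fun_add (hf : ContDiffAt ℝ 2 f x) (hg : ContDiffAt ℝ 2 g x) :
    Δ (fun y => f y + g y) x = Δ f x + Δ g x := hf.laplacian_add hg

theorem laplacian_fun_sub (hf : ContDiffAt ℝ 2 f x) (hg : ContDiffAt ℝ 2 g x) :
    Δ (fun y => f y - g y) x = Δ f x - Δ g x := hf.laplacian_sub hg

theorem laplacian_fun_const_mul (c : ℝ) (hf : ContDiffAt ℝ 2 f x) :
    Δ (fun y => c * f y) x = c * Δ f x :=
  InnerProductSpace.laplacian_smul c hf

theorem laplacian_fun_sum {ι : Type*} (s : Finset ι) {F : ι → EuclideanSpace ℝ (Fin n) → ℝ}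
    (hF : ∀ i ∈ s, ContDiffAt ℝ 2 (F i) x) :
    Δ (fun y => ∑ i ∈ s, F i y) x = ∑ i ∈ s, Δ (F i) x := by
  classical
  induction s using Finset.induction_on with
  | empty =>
    simp
  | insert a s ha ih =>
    simp only [Finset.sum_insert ha]
    rw [laplacian_fun_add (hF a (Finset.mem_insert_self a s))
      (ContDiffAt.sum fun i hi => hF i (Finset.mem_insert_of_mem hi)),
      ih fun i hi => hF i (Finset.mem_insert_of_mem hi)]

theorem laplacian_comp_coord {φ : ℝ → ℝ} (hφ : ContDiff ℝ 2 φ) (i : Fin n) :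
    Δ (fun y : EuclideanSpace ℝ (Fin n) => φ (y i)) x = deriv (deriv φ) (x i) := by
  have hf : ContDiff ℝ 2 (fun y : EuclideanSpace ℝ (Fin n) => φ (y i)) :=
    hφ.comp (EuclideanSpace.proj (𝕜 := ℝ) i).contDiff
  rw [laplacian_eq_sum, Finset.sum_eq_single i]
  · rw [← deriv_deriv_line hf.contDiffAt]
    have h1 : (deriv fun t : ℝ => φ ((x + t • EuclideanSpace.single i (1 : ℝ)) i))
        = fun s => deriv φ (x i + s) := by
      funext s
      simp [deriv_comp_const_add]
    rw [h1, deriv_comp_const_add (f := deriv φ), add_zero]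
  · intro j _ hj
    rw [← deriv_deriv_line hf.contDiffAt]
    have h1 : (fun t : ℝ => φ ((x + t • EuclideanSpace.single j (1 : ℝ)) i)) = fun _ => φ (x i) := by
      funext s
      simp [hj.symm]
    rw [h1]
    simp
  · simp

end LaplacianAlgebra

/-! ### A harmonic barrier concentrated away from a vertical line -/

/-- The horizontal factor of the barrier. -/
noncomputable def coshSum {m : ℕ} (κ : ℝ) (x₀ y : EuclideanSpace ℝ (Fin m)) : ℝ :=
  ∑ i, Real.cosh (κ * (y i - x₀ i))

theorem contDiff_cosh_affine (κ a : ℝ) : ContDiff ℝ 2 fun t : ℝ => Real.cosh (κ * (t - a)) :=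
  Real.contDiff_cosh.comp (by fun_prop)

theorem contDiff_coshSum {m : ℕ} (κ : ℝ) (x₀ : EuclideanSpace ℝ (Fin m)) :
    ContDiff ℝ 2 (coshSum κ x₀) := by
  unfold coshSum
  refine ContDiff.sum fun i _ => ?_
  exact (contDiff_cosh_affine κ (x₀ i)).comp (EuclideanSpace.proj (𝕜 := ℝ) i).contDiff

theorem deriv_deriv_cosh_affine (κ a t : ℝ) :
    deriv (deriv fun t : ℝ => Real.cosh (κ * (t - a))) t = κ ^ 2 * Real.cosh (κ * (t - a)) := by
  have h0 (t : ℝ) : HasDerivAt (fun t : ℝ => κ * (t - a)) κ t := by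
    simpa using ((hasDerivAt_id t).sub_const a).const_mul κ
  have h1 : (deriv fun t : ℝ => Real.cosh (κ * (t - a)))
      = fun t => Real.sinh (κ * (t - a)) * κ := by
    funext t
    exact (h0 t).cosh.deriv
  rw [h1, ((h0 t).sinh.mul_const κ).deriv]
  ring

theorem deriv_deriv_cos_mul (κ t : ℝ) :
    deriv (deriv fun t : ℝ => Real.cos (κ * t)) t = -(κ ^ 2 * Real.cos (κ * t)) := by
  have h0 (t : ℝ) : HasDerivAt (fun t : ℝ => κ * t) κ t := by
    simpa using (hasDerivAt_id t).const_mul κ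
  have h1 : (deriv fun t : ℝ => Real.cos (κ * t)) = fun t => -Real.sin (κ * t) * κ := by
    funext t
    exact (h0 t).cos.deriv
  have h2 : HasDerivAt (fun t : ℝ => -Real.sin (κ * t) * κ) (-(Real.cos (κ * t) * κ) * κ) t :=
    (h0 t).sin.neg.mul_const κ
  rw [h1, h2.deriv]
  ring

/-- The eigenvalue `κ ^ 2` cancels the `-κ ^ 2` of `cos (κ * height)`, so the product of the two is
harmonic. -/
theorem laplacian_coshSum {m : ℕ} (κ : ℝ) (x₀ y : EuclideanSpace ℝ (Fin m)) :
    Δ (coshSum κ x₀) y = κ ^ 2 * coshSum κ x₀ y := by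
  unfold coshSum
  rw [laplacian_fun_sum, Finset.mul_sum]
  · refine Finset.sum_congr rfl fun i _ => ?_
    rw [laplacian_comp_coord (contDiff_cosh_affine κ (x₀ i)) i, deriv_deriv_cosh_affine]
  · intro i _
    exact ((contDiff_cosh_affine κ (x₀ i)).comp
      (EuclideanSpace.proj (𝕜 := ℝ) i).contDiff).contDiffAt

theorem coshSum_nonneg {m : ℕ} (κ : ℝ) (x₀ y : EuclideanSpace ℝ (Fin m)) :
    0 ≤ coshSum κ x₀ y :=
  Finset.sum_nonneg fun _ _ => (Real.cosh_pos _).le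

theorem coshSum_self {m : ℕ} (κ : ℝ) (x₀ : EuclideanSpace ℝ (Fin m)) : coshSum κ x₀ x₀ = m := by
  simp [coshSum]

/-- The Euclidean distance is at most the sum of the coordinate differences, so one of them is at
least `ρ / m`. -/
theorem cosh_le_coshSum {m : ℕ} (hm : 1 ≤ m) {κ ρ : ℝ} (hρ : 0 ≤ ρ)
    {x₀ y : EuclideanSpace ℝ (Fin m)} (hy : ρ ≤ dist y x₀) :
    Real.cosh (κ * (ρ / m)) ≤ coshSum κ x₀ y := by
  have hm0 : (0 : ℝ) < m := by exact_mod_cast hm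
  obtain ⟨i, hi⟩ : ∃ i, ρ / m ≤ |y i - x₀ i| := by
    by_contra! hlt
    have h1 : dist y x₀ ≤ ∑ i, |y i - x₀ i| := by
      rw [EuclideanSpace.dist_eq]
      refine Real.sqrt_le_iff.2 ⟨Finset.sum_nonneg fun i _ => abs_nonneg _, ?_⟩
      simp only [Real.dist_eq]
      exact Finset.sum_sq_le_sq_sum_of_nonneg fun i _ => abs_nonneg _
    have h2 : ∑ i, |y i - x₀ i| < ∑ _i : Fin m, ρ / m :=
      Finset.sum_lt_sum_of_nonempty ⟨⟨0, hm⟩, Finset.mem_univ _⟩ fun i _ => hlt i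
    have h3 : ∑ _i : Fin m, ρ / m = ρ := by
      simp; field_simp
    linarith
  calc Real.cosh (κ * (ρ / m)) ≤ Real.cosh (κ * (y i - x₀ i)) := by
        rw [Real.cosh_le_cosh, abs_mul, abs_mul, abs_of_nonneg (div_nonneg hρ hm0.le)]
        exact mul_le_mul_of_nonneg_left hi (abs_nonneg _)
    _ ≤ coshSum κ x₀ y :=
        Finset.single_le_sum (f := fun i => Real.cosh (κ * (y i - x₀ i)))
          (fun j _ => (Real.cosh_pos _).le) (Finset.mem_univ i)

/-- The damping is in fact exponential; the fourth power suffices to turn lateral data of size `ε ^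
2` into `ε ^ 6`. -/
theorem pow_four_le_cosh {z : ℝ} (hz : 0 ≤ z) : z ^ 4 / 48 ≤ Real.cosh z := by
  have h1 := Real.pow_div_factorial_le_exp z hz 4
  have h2 : Real.exp z / 2 ≤ Real.cosh z := by
    rw [Real.cosh_eq]
    have := Real.exp_pos (-z)
    linarith
  have h3 : ((Nat.factorial 4 : ℕ) : ℝ) = 24 := by norm_num [Nat.factorial]
  rw [h3] at h1
  linarith

/-- The part of `Ω` lying over the ball of radius `ρ` around `x₀`. -/
def cylinder {m : ℕ} (Ω : Set (EuclideanSpace ℝ (Fin (m + 1))))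
    (x₀ : EuclideanSpace ℝ (Fin m)) (ρ : ℝ) : Set (EuclideanSpace ℝ (Fin (m + 1))) :=
  {x | x ∈ Ω ∧ dist (base x) x₀ < ρ}

theorem isOpen_cylinder {m : ℕ} {Ω : Set (EuclideanSpace ℝ (Fin (m + 1)))} (hΩ : IsOpen Ω)
    (x₀ : EuclideanSpace ℝ (Fin m)) (ρ : ℝ) : IsOpen (cylinder Ω x₀ ρ) :=
  hΩ.inter (isOpen_lt (continuous_base.dist continuous_const) continuous_const)

theorem dist_base_le_of_mem_closure_cylinder {m : ℕ} {Ω : Set (EuclideanSpace ℝ (Fin (m + 1)))}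
    {x₀ : EuclideanSpace ℝ (Fin m)} {ρ : ℝ} {x : EuclideanSpace ℝ (Fin (m + 1))}
    (hx : x ∈ closure (cylinder Ω x₀ ρ)) : dist (base x) x₀ ≤ ρ := by
  have hc : IsClosed {x : EuclideanSpace ℝ (Fin (m + 1)) | dist (base x) x₀ ≤ ρ} :=
    isClosed_le (continuous_base.dist continuous_const) continuous_const
  exact closure_minimal (fun y hy => hy.2.le) hc hx

theorem closure_cylinder_subset {m : ℕ} (Ω : Set (EuclideanSpace ℝ (Fin (m + 1))))
    (x₀ : EuclideanSpace ℝ (Fin m)) (ρ : ℝ) : closure (cylinder Ω x₀ ρ) ⊆ closure Ω :=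
  closure_mono fun _ hx => hx.1

/-- Localised comparison in a thin set: the influence of the lateral boundary of a cylinder of
radius `ρ` on its axis is of order `(l / ρ) ^ 4`, where `l` bounds the height of the set. -/
theorem le_on_axis_of_laplacian_ge {m : ℕ} (hm : 1 ≤ m)
    {Ω : Set (EuclideanSpace ℝ (Fin (m + 1)))} (hΩ : IsOpen Ω) (hΩb : Bornology.IsBounded Ω)
    {l : ℝ} (hl : 0 < l) (hΩl : ∀ x ∈ closure Ω, |height x| ≤ l)
    {x₀ : EuclideanSpace ℝ (Fin m)} {ρ : ℝ} (hρ : 0 < ρ)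
    {w : EuclideanSpace ℝ (Fin (m + 1)) → ℝ} (hw : ContDiffOn ℝ 2 w (cylinder Ω x₀ ρ))
    (hwc : ContinuousOn w (closure (cylinder Ω x₀ ρ))) {K A : ℝ} (hK : 0 ≤ K) (hA : 0 ≤ A)
    (hΔ : ∀ x ∈ cylinder Ω x₀ ρ, -K ≤ Δ w x)
    (hbd : ∀ x ∈ closure (cylinder Ω x₀ ρ), x ∉ Ω → w x ≤ 0)
    (hwA : ∀ x ∈ closure (cylinder Ω x₀ ρ), x ∈ Ω → w x ≤ A) :
    ∀ x ∈ Ω, base x = x₀ → w x ≤ K * l ^ 2 / 2 + A * (96 * m ^ 5 * (l / ρ) ^ 4) := by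
  have hm0 : (0 : ℝ) < m := by exact_mod_cast hm
  -- With this frequency `|κ * height| ≤ 1` on the closure, hence the cosine is at least `1 / 2`
  -- there.
  set κ : ℝ := 1 / l with hκ
  have hκ0 : 0 < κ := by positivity
  set M : ℝ := Real.cosh (κ * (ρ / m)) with hM
  have hM0 : 0 < M := Real.cosh_pos _
  -- On the lateral boundary the horizontal factor is at least `M` and the cosine at least `1 / 2`,
  -- so the barrier times `c` dominates `A`.
  set c : ℝ := 2 * A / M with hc
  have hc0 : 0 ≤ c := by positivity
  -- The term `K / 2 * height ^ 2` has Laplacian `K` and offsets the source; subtracting `K / 2 * l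
  -- ^ 2` restores the sign on the boundary.
  set ψ : EuclideanSpace ℝ (Fin (m + 1)) → ℝ := fun x =>
    w x + K / 2 * (height x ^ 2) - c * (coshSum κ x₀ (base x) * Real.cos (κ * height x))
      - K / 2 * l ^ 2 with hψ
  have hcosd : ContDiff ℝ 2 fun t : ℝ => Real.cos (κ * t) := by fun_prop
  have hsqd : ContDiff ℝ 2 fun t : ℝ => t ^ 2 := by fun_prop
  have hq1 : ContDiff ℝ 2 fun x : EuclideanSpace ℝ (Fin (m + 1)) => (K / 2) * height x ^ 2 :=
    contDiff_const.mul (hsqd.comp contDiff_height)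
  have hq2 : ContDiff ℝ 2 fun x : EuclideanSpace ℝ (Fin (m + 1)) =>
      coshSum κ x₀ (base x) * Real.cos (κ * height x) :=
    ((contDiff_coshSum κ x₀).comp contDiff_base).mul (hcosd.comp contDiff_height)
  have hq3 := contDiff_const (c := c) |>.mul hq2
  have hcyl := isOpen_cylinder hΩ x₀ ρ
  have hcos : ∀ x ∈ closure Ω, 1 / 2 ≤ Real.cos (κ * height x) := by
    intro x hx
    have h1 := Real.one_sub_sq_div_two_le_cos (x := κ * height x)
    have h2 : |κ * height x| ≤ 1 := by
      rw [abs_mul, abs_of_pos hκ0, hκ, one_div, inv_mul_le_iff₀ hl, mul_one]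
      exact hΩl x hx
    have h3 := (sq_le_one_iff_abs_le_one _).2 h2
    linarith
  have hheight : ∀ x ∈ closure Ω, height x ^ 2 ≤ l ^ 2 := fun x hx =>
    sq_le_sq' (abs_le.1 (hΩl x hx)).1 (abs_le.1 (hΩl x hx)).2
  have hmp := nonpos_of_laplacian_nonneg (w := ψ) hcyl (hΩb.subset fun x hx => hx.1)
    (((hw.add hq1.contDiffOn).sub hq3.contDiffOn).sub contDiffOn_const)
    (((hwc.add hq1.continuous.continuousOn).sub hq3.continuous.continuousOn).sub
      continuousOn_const) ?_ ?_
  · intro x hx hxx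
    have hxc : x ∈ closure (cylinder Ω x₀ ρ) := subset_closure ⟨hx, by simpa [hxx] using hρ⟩
    have h1 := hmp x hxc
    simp only [hψ, hxx, coshSum_self] at h1
    have h2 : c * (m * Real.cos (κ * height x)) ≤ c * m :=
      mul_le_mul_of_nonneg_left (mul_le_of_le_one_right hm0.le (Real.cos_le_one _)) hc0
    have h3 : c * m ≤ A * (96 * m ^ 5 * (l / ρ) ^ 4) := by
      have h4 : (κ * (ρ / m)) ^ 4 / 48 ≤ M := pow_four_le_cosh (by positivity)
      rw [hc, div_mul_eq_mul_div, div_le_iff₀ hM0]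
      calc 2 * A * m = A * (96 * m ^ 5 * (l / ρ) ^ 4) * ((κ * (ρ / m)) ^ 4 / 48) := by
            rw [hκ]; field_simp; ring
        _ ≤ _ := mul_le_mul_of_nonneg_left h4 (by positivity)
    have h5 : 0 ≤ K / 2 * height x ^ 2 := by positivity
    linarith
  · intro x hx
    have hwx : ContDiffAt ℝ 2 w x := hw.contDiffAt (hcyl.mem_nhds hx)
    rw [hψ, laplacian_fun_sub ((hwx.add hq1.contDiffAt).sub hq3.contDiffAt) contDiffAt_const,
      laplacian_fun_sub (hwx.add hq1.contDiffAt) hq3.contDiffAt,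
      laplacian_fun_add hwx hq1.contDiffAt, laplacian_fun_const_mul _ hq2.contDiffAt,
      laplacian_base_mul_height (k := fun t => Real.cos (κ * t))
        (contDiff_coshSum κ x₀).contDiffAt hcosd.contDiffAt,
      laplacian_base_mul_height (g := fun _ => K / 2) (k := fun t => t ^ 2) contDiffAt_const
        hsqd.contDiffAt, laplacian_coshSum, deriv_deriv_cos_mul]
    have h1 : deriv (deriv fun t : ℝ => t ^ 2) = fun _ => 2 := by
      have : (deriv fun t : ℝ => t ^ 2) = fun t => 2 * t := by funext t; simp
      rw [this]; funext t; simp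
    have := hΔ x hx
    simp only [h1, InnerProductSpace.laplacian_const, Pi.zero_apply]
    linarith
  · intro x hx hxn
    have hxΩ := closure_cylinder_subset Ω x₀ ρ hx
    have h1 := hcos x hxΩ
    have h2 : K / 2 * height x ^ 2 ≤ K / 2 * l ^ 2 :=
      mul_le_mul_of_nonneg_left (hheight x hxΩ) (by positivity)
    have h3 := coshSum_nonneg κ x₀ (base x)
    simp only [hψ]
    by_cases hxin : x ∈ Ω
    · have hd : ρ ≤ dist (base x) x₀ := not_lt.1 fun h => hxn ⟨hxin, h⟩
      have h4 : M ≤ coshSum κ x₀ (base x) := cosh_le_coshSum hm hρ.le hd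
      have h5 : c * (M * (1 / 2)) ≤ c * (coshSum κ x₀ (base x) * Real.cos (κ * height x)) :=
        mul_le_mul_of_nonneg_left (mul_le_mul h4 h1 (by norm_num) h3) hc0
      have h6 : c * (M * (1 / 2)) = A := by rw [hc]; field_simp
      have := hwA x hx hxin
      linarith
    · have h5 : 0 ≤ c * (coshSum κ x₀ (base x) * Real.cos (κ * height x)) :=
        mul_nonneg hc0 (mul_nonneg h3 (by linarith))
      have := hbd x hx hxin
      linarith

/-! ### Geometry of thin domains -/

section Geometry

variable {m : ℕ} {ω : Set (EuclideanSpace ℝ (Fin m))} {a b : EuclideanSpace ℝ (Fin m) → ℝ}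
  {ε : ℝ}

theorem isOpen_thinDomain (hω : IsOpen ω) (ha : ContinuousOn a (closure ω))
    (hb : ContinuousOn b (closure ω)) : IsOpen (thinDomain ω a b ε) := by
  rw [isOpen_iff_mem_nhds]
  rintro x ⟨hx, h1, h2⟩
  have hn : closure ω ∈ nhds (base x) := Filter.mem_of_superset (hω.mem_nhds hx) subset_closure
  have hbase : ContinuousAt (base (m := m)) x := continuous_base.continuousAt
  have ha' : ContinuousAt (fun y => -(ε * a (base y))) x :=
    (continuousAt_const.mul ((ha.continuousAt hn).comp hbase)).neg
  have hb' : ContinuousAt (fun y => ε * b (base y)) x :=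
    continuousAt_const.mul ((hb.continuousAt hn).comp hbase)
  filter_upwards [hbase (hω.mem_nhds hx), ha'.eventually_lt continuous_height.continuousAt h1,
    continuous_height.continuousAt.eventually_lt hb' h2] with y h3 h4 h5
  exact ⟨h3, h4, h5⟩

theorem mem_closure_thinDomain (ha : ContinuousOn a (closure ω)) (hb : ContinuousOn b (closure ω))
    {x : EuclideanSpace ℝ (Fin (m + 1))} (hx : x ∈ closure (thinDomain ω a b ε)) :
    base x ∈ closure ω ∧ -(ε * a (base x)) ≤ height x ∧ height x ≤ ε * b (base x) := by
  have hmaps : Set.MapsTo (base (m := m)) (thinDomain ω a b ε) (closure ω) :=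
    fun y hy => subset_closure hy.1
  have hbx : base x ∈ closure ω :=
    closure_minimal hmaps (isClosed_closure.preimage continuous_base) hx
  have hbase : ContinuousWithinAt (base (m := m)) (thinDomain ω a b ε) x :=
    continuous_base.continuousWithinAt
  have ha' : ContinuousWithinAt (fun y => -(ε * a (base y))) (thinDomain ω a b ε) x :=
    (continuousWithinAt_const.mul ((ha _ hbx).comp hbase hmaps)).neg
  have hb' : ContinuousWithinAt (fun y => ε * b (base y)) (thinDomain ω a b ε) x :=
    continuousWithinAt_const.mul ((hb _ hbx).comp hbase hmaps)
  refine ⟨hbx, ?_, ?_⟩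
  · exact ContinuousWithinAt.closure_le hx ha' continuous_height.continuousWithinAt
      fun y hy => hy.2.1.le
  · exact ContinuousWithinAt.closure_le hx continuous_height.continuousWithinAt hb'
      fun y hy => hy.2.2.le

theorem abs_height_le_of_mem_closure (ha : ContinuousOn a (closure ω))
    (hb : ContinuousOn b (closure ω)) (hε : 0 ≤ ε) {L : ℝ}
    (haL : ∀ y ∈ closure ω, |a y| ≤ L) (hbL : ∀ y ∈ closure ω, |b y| ≤ L)
    {x : EuclideanSpace ℝ (Fin (m + 1))} (hx : x ∈ closure (thinDomain ω a b ε)) :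
    |height x| ≤ L * ε := by
  obtain ⟨h1, h2, h3⟩ := mem_closure_thinDomain ha hb hx
  have h4 := mul_le_mul_of_nonneg_left ((le_abs_self _).trans (haL _ h1)) hε
  have h5 := mul_le_mul_of_nonneg_left ((le_abs_self _).trans (hbL _ h1)) hε
  rw [abs_le]
  constructor <;> linarith

theorem norm_sq_eq_base_height (x : EuclideanSpace ℝ (Fin (m + 1))) :
    ‖x‖ ^ 2 = ‖base x‖ ^ 2 + height x ^ 2 := by
  rw [EuclideanSpace.norm_sq_eq, EuclideanSpace.norm_sq_eq, Fin.sum_univ_castSucc]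
  simp [base, height]

theorem isBounded_thinDomain (hω : Bornology.IsBounded ω) (ha : ContinuousOn a (closure ω))
    (hb : ContinuousOn b (closure ω)) (hε : 0 ≤ ε) {L : ℝ}
    (haL : ∀ y ∈ closure ω, |a y| ≤ L) (hbL : ∀ y ∈ closure ω, |b y| ≤ L) :
    Bornology.IsBounded (thinDomain ω a b ε) := by
  obtain ⟨R, hR⟩ := hω.exists_norm_le
  refine isBounded_iff_forall_norm_le.2 ⟨R + L * ε, fun x hx => ?_⟩
  have h1 := hR _ hx.1
  have h2 := abs_height_le_of_mem_closure ha hb hε haL hbL (subset_closure hx)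
  have h3 : ‖x‖ ^ 2 ≤ (R + L * ε) ^ 2 := by
    rw [norm_sq_eq_base_height, ← sq_abs (height x)]
    have := norm_nonneg (base x)
    have := abs_nonneg (height x)
    nlinarith
  exact (sq_le_sq₀ (norm_nonneg x)
    (by linarith [norm_nonneg (base x), abs_nonneg (height x)])).1 h3

theorem height_eq_of_mem_closure_of_notMem (ha : ContinuousOn a (closure ω))
    (hb : ContinuousOn b (closure ω)) {x : EuclideanSpace ℝ (Fin (m + 1))}
    (hx : x ∈ closure (thinDomain ω a b ε)) (hxn : x ∉ thinDomain ω a b ε) (hbx : base x ∈ ω) :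
    height x = -(ε * a (base x)) ∨ height x = ε * b (base x) := by
  obtain ⟨-, h2, h3⟩ := mem_closure_thinDomain ha hb hx
  by_contra! h
  exact hxn ⟨hbx, lt_of_le_of_ne h2 h.1.symm, lt_of_le_of_ne h3 h.2⟩

end Geometry

theorem IsTorsionFunction.eq_zero {n : ℕ} {Ω : Set (EuclideanSpace ℝ (Fin n))}
    {u : EuclideanSpace ℝ (Fin n) → ℝ} (hu : IsTorsionFunction Ω u) (hΩ : IsOpen Ω)
    {x : EuclideanSpace ℝ (Fin n)} (hx : x ∈ closure Ω) (hxn : x ∉ Ω) : u x = 0 :=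
  hu.boundary x ⟨hx, by rwa [hΩ.interior_eq]⟩

/-! ### Rough bounds for the torsion function -/

theorem hasDerivAt_quadratic (A B C t : ℝ) :
    HasDerivAt (fun t : ℝ => A + B * t + C * t ^ 2) (B + C * (2 * t)) t := by
  have h := (((hasDerivAt_id t).const_mul B).const_add A).add ((hasDerivAt_pow 2 t).const_mul C)
  exact h.congr_deriv (by simp)

theorem deriv_deriv_quadratic (A B C : ℝ) :
    deriv (deriv fun t : ℝ => A + B * t + C * t ^ 2) = fun _ => 2 * C := by
  have h1 : (deriv fun t : ℝ => A + B * t + C * t ^ 2) = fun t => B + C * (2 * t) := by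
    funext t
    exact (hasDerivAt_quadratic A B C t).deriv
  rw [h1]
  funext t
  have h2 : HasDerivAt (fun t : ℝ => B + C * (2 * t)) (C * (2 * 1)) t :=
    (((hasDerivAt_id t).const_mul 2).const_mul C).const_add B
  rw [h2.deriv]
  ring

theorem contDiff_quadratic_height {m : ℕ} (A B C : ℝ) :
    ContDiff ℝ 2 fun x : EuclideanSpace ℝ (Fin (m + 1)) =>
      A + B * height x + C * height x ^ 2 := by
  have := contDiff_height (m := m) (k := 2)
  fun_prop

theorem laplacian_quadratic_height {m : ℕ} (A B C : ℝ) (x : EuclideanSpace ℝ (Fin (m + 1))) :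
    Δ (fun x : EuclideanSpace ℝ (Fin (m + 1)) => A + B * height x + C * height x ^ 2) x
      = 2 * C := by
  have h := laplacian_base_mul_height (m := m) (g := fun _ => 1)
    (k := fun t => A + B * t + C * t ^ 2) (x := x) contDiffAt_const (by fun_prop)
  simpa [deriv_deriv_quadratic] using h

section Torsion

variable {m : ℕ} {Ω : Set (EuclideanSpace ℝ (Fin (m + 1)))}
  {u : EuclideanSpace ℝ (Fin (m + 1)) → ℝ}

theorem IsTorsionFunction.nonneg (hu : IsTorsionFunction Ω u) (hΩ : IsOpen Ω)
    (hΩb : Bornology.IsBounded Ω) {x : EuclideanSpace ℝ (Fin (m + 1))} (hx : x ∈ closure Ω) :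
    0 ≤ u x := by
  have h := nonpos_of_laplacian_nonneg (w := -u) hΩ hΩb hu.contDiffOn.neg hu.continuousOn.neg ?_
    (fun y hy hyn => by simp [hu.eq_zero hΩ hy hyn]) x hx
  · simpa using h
  · intro y hy
    have h1 : Δ (-u) y = -Δ u y := congrFun InnerProductSpace.laplacian_neg y
    rw [h1, hu.neg_laplacian y hy]
    norm_num

/-- The parabola `l ^ 2 - height ^ 2` has Laplacian `-2` and is nonnegative on the closure. -/
theorem IsTorsionFunction.le_sq (hu : IsTorsionFunction Ω u) (hΩ : IsOpen Ω)
    (hΩb : Bornology.IsBounded Ω) {l : ℝ} (hl : ∀ x ∈ closure Ω, |height x| ≤ l)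
    {x : EuclideanSpace ℝ (Fin (m + 1))} (hx : x ∈ closure Ω) : u x ≤ l ^ 2 := by
  have hq := contDiff_quadratic_height (m := m) (l ^ 2) 0 (-1)
  have h := nonpos_of_laplacian_nonneg
    (w := fun y => u y - (l ^ 2 + 0 * height y + (-1) * height y ^ 2)) hΩ hΩb
    (hu.contDiffOn.sub hq.contDiffOn) (hu.continuousOn.sub hq.continuous.continuousOn) ?_ ?_ x hx
  · have := sq_nonneg (height x)
    linarith
  · intro y hy
    rw [laplacian_fun_sub (hu.contDiffOn.contDiffAt (hΩ.mem_nhds hy)) hq.contDiffAt,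
      laplacian_quadratic_height]
    have := hu.neg_laplacian y hy
    linarith
  · intro y hy hyn
    have h1 : height y ^ 2 ≤ l ^ 2 :=
      sq_le_sq' (abs_le.1 (hl y hy)).1 (abs_le.1 (hl y hy)).2
    simp only [hu.eq_zero hΩ hy hyn]
    linarith

/-- If, over a ball around `x₀`, the set `Ω` lies in the strip `-α ≤ height ≤ β`, then above `x₀`
the torsion function is at most the maximum of that of the strip, up to a small error. -/
theorem IsTorsionFunction.le_strip (hm : 1 ≤ m) (hu : IsTorsionFunction Ω u) (hΩ : IsOpen Ω)
    (hΩb : Bornology.IsBounded Ω) {l : ℝ} (hl0 : 0 < l) (hl : ∀ x ∈ closure Ω, |height x| ≤ l)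
    {x₀ : EuclideanSpace ℝ (Fin m)} {ρ α β : ℝ} (hρ : 0 < ρ)
    (hstrip : ∀ x ∈ closure (cylinder Ω x₀ ρ), -α ≤ height x ∧ height x ≤ β)
    {x : EuclideanSpace ℝ (Fin (m + 1))} (hx : x ∈ Ω) (hx₀ : base x = x₀) :
    u x ≤ (α + β) ^ 2 / 4 + l ^ 2 * (96 * m ^ 5 * (l / ρ) ^ 4) := by
  -- This is `(height + α) * (β - height)`, the torsion function of the strip, with maximum `(α + β)
  -- ^ 2 / 4`. Its difference from `u` is harmonic, so the comparison runs with `K = 0`, and the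
  -- crude bound `l ^ 2` serves as lateral data.
  have hq := contDiff_quadratic_height (m := m) (α * β) (β - α) (-1)
  have hsub := closure_cylinder_subset Ω x₀ ρ
  have hnn : ∀ y ∈ closure (cylinder Ω x₀ ρ),
      0 ≤ α * β + (β - α) * height y + (-1) * height y ^ 2 := by
    intro y hy
    have h1 := (hstrip y hy).1
    have h2 := (hstrip y hy).2
    nlinarith [mul_nonneg (sub_nonneg.2 h1) (sub_nonneg.2 h2)]
  have h := le_on_axis_of_laplacian_ge hm hΩ hΩb hl0 hl hρ
    (w := fun y => u y - (α * β + (β - α) * height y + (-1) * height y ^ 2)) (K := 0)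
    (A := l ^ 2)
    ((hu.contDiffOn.mono fun y hy => hy.1).sub hq.contDiffOn)
    ((hu.continuousOn.mono hsub).sub hq.continuous.continuousOn) le_rfl (sq_nonneg l) ?_ ?_ ?_
    x hx hx₀
  · nlinarith [sq_nonneg (height x - (β - α) / 2)]
  · intro y hy
    rw [laplacian_fun_sub (hu.contDiffOn.contDiffAt (hΩ.mem_nhds hy.1)) hq.contDiffAt,
      laplacian_quadratic_height]
    have := hu.neg_laplacian y hy.1
    linarith
  · intro y hy hyn
    have := hnn y hy
    simp only [hu.eq_zero hΩ (hsub hy) hyn]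
    linarith
  · intro y hy _
    have := hnn y hy
    have := hu.le_sq hΩ hΩb hl (hsub hy)
    linarith

end Torsion

/-! ### The approximate solution -/

/-- The coefficient `Δd / 6` of the linear part of the second-order corrector. -/
noncomputable def linearCoeff {m : ℕ} (d : EuclideanSpace ℝ (Fin m) → ℝ) :
    EuclideanSpace ℝ (Fin m) → ℝ :=
  fun y => 1 / 6 * Δ d y

/-- The constant coefficient `Δp / 2 + d Δd / 6` of the second-order corrector. -/
noncomputable def constCoeff {m : ℕ} (p d : EuclideanSpace ℝ (Fin m) → ℝ) :
    EuclideanSpace ℝ (Fin m) → ℝ :=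
  fun y => 1 / 2 * Δ p y + d y * linearCoeff d y

/-- The two-term asymptotic expansion of the torsion function of a thin domain. -/
noncomputable def profile {m : ℕ} (p d : EuclideanSpace ℝ (Fin m) → ℝ) (ε : ℝ)
    (x : EuclideanSpace ℝ (Fin (m + 1))) : ℝ :=
  (ε ^ 2 * p (base x) + ε * d (base x) * height x - height x ^ 2) *
    (1 + ε ^ 2 * constCoeff p d (base x) + ε * linearCoeff d (base x) * height x)

/-- The residual of `profile`, see `laplacian_profile`. -/
noncomputable def residual {m : ℕ} (p d : EuclideanSpace ℝ (Fin m) → ℝ) (ε : ℝ)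
    (x : EuclideanSpace ℝ (Fin (m + 1))) : ℝ :=
  ε ^ 4 * Δ (fun y => p y * constCoeff p d y) (base x)
    + ε ^ 3 * Δ (fun y => d y * constCoeff p d y + p y * linearCoeff d y) (base x) * height x
    + ε ^ 2 * Δ (fun y => -(1 / 2) * Δ p y) (base x) * height x ^ 2
    - ε * Δ (linearCoeff d) (base x) * height x ^ 3

section Profile

variable {m : ℕ} {p d : EuclideanSpace ℝ (Fin m) → ℝ}

theorem contDiffAt_linearCoeff {y : EuclideanSpace ℝ (Fin m)} (hΔd : ContDiffAt ℝ 2 (Δ d) y) :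
    ContDiffAt ℝ 2 (linearCoeff d) y :=
  contDiffAt_const.mul hΔd

theorem contDiffAt_constCoeff {y : EuclideanSpace ℝ (Fin m)} (hd : ContDiffAt ℝ 2 d y)
    (hΔp : ContDiffAt ℝ 2 (Δ p) y) (hΔd : ContDiffAt ℝ 2 (Δ d) y) :
    ContDiffAt ℝ 2 (constCoeff p d) y :=
  (contDiffAt_const.mul hΔp).add (hd.mul (contDiffAt_linearCoeff hΔd))

theorem contDiffAt_profile {ε : ℝ} {x : EuclideanSpace ℝ (Fin (m + 1))}
    (hp : ContDiffAt ℝ 2 p (base x)) (hd : ContDiffAt ℝ 2 d (base x))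
    (hΔp : ContDiffAt ℝ 2 (Δ p) (base x)) (hΔd : ContDiffAt ℝ 2 (Δ d) (base x)) :
    ContDiffAt ℝ 2 (profile p d ε) x := by
  have hb : ContDiffAt ℝ 2 (base (m := m)) x := contDiff_base.contDiffAt
  have hh : ContDiffAt ℝ 2 (height (m := m)) x := contDiff_height.contDiffAt
  have h1 := hp.comp x hb
  have h2 := hd.comp x hb
  have h3 := (contDiffAt_constCoeff hd hΔp hΔd).comp x hb
  have h4 := (contDiffAt_linearCoeff hΔd).comp x hb
  exact (((contDiffAt_const.mul h1).add ((contDiffAt_const.mul h2).mul hh)).sub (hh.pow 2)).mul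
    ((contDiffAt_const.add (contDiffAt_const.mul h3)).add ((contDiffAt_const.mul h4).mul hh))

theorem deriv_deriv_pow (n : ℕ) :
    deriv (deriv fun t : ℝ => t ^ n) = fun t : ℝ => n * ((n - 1 : ℕ) * t ^ (n - 1 - 1)) := by
  have h1 : (deriv fun t : ℝ => t ^ n) = fun t : ℝ => n * t ^ (n - 1) := by
    funext t; simp
  rw [h1]
  funext t
  rw [deriv_const_mul_field]
  simp

/-- Written as a cubic in the height, the profile has `height²` coefficient `-1 - ε² Δp / 2`, thanks
to the term `d Δd / 6` in `constCoeff`. Its vertical second derivative cancels the `ε² Δp` of the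
constant term, and the cubic term `-ε Δd / 6` cancels the `ε Δd` of the linear one. -/
theorem laplacian_profile {ε : ℝ} {x : EuclideanSpace ℝ (Fin (m + 1))}
    (hp : ContDiffAt ℝ 2 p (base x)) (hd : ContDiffAt ℝ 2 d (base x))
    (hΔp : ContDiffAt ℝ 2 (Δ p) (base x)) (hΔd : ContDiffAt ℝ 2 (Δ d) (base x)) :
    Δ (profile p d ε) x = -2 + residual p d ε x := by
  have hα := contDiffAt_linearCoeff hΔd
  have hβ := contDiffAt_constCoeff hd hΔp hΔd
  have hpβ : ContDiffAt ℝ 2 (fun y => p y * constCoeff p d y) (base x) := hp.mul hβ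
  have hg1 : ContDiffAt ℝ 2 (fun y => d y * constCoeff p d y + p y * linearCoeff d y) (base x) :=
    (hd.mul hβ).add (hp.mul hα)
  have hg2 : ContDiffAt ℝ 2 (fun y => -(1 / 2) * Δ p y) (base x) := contDiffAt_const.mul hΔp
  have hG0 : ContDiffAt ℝ 2 (fun y => ε ^ 2 * p y + ε ^ 4 * (p y * constCoeff p d y)) (base x) :=
    (contDiffAt_const.mul hp).add (contDiffAt_const.mul hpβ)
  have hG1 : ContDiffAt ℝ 2 (fun y => ε * d y
      + ε ^ 3 * (d y * constCoeff p d y + p y * linearCoeff d y)) (base x) :=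
    (contDiffAt_const.mul hd).add (contDiffAt_const.mul hg1)
  have hG2 : ContDiffAt ℝ 2 (fun y => -1 + ε ^ 2 * (-(1 / 2) * Δ p y)) (base x) :=
    contDiffAt_const.add (contDiffAt_const.mul hg2)
  have hG3 : ContDiffAt ℝ 2 (fun y => (-ε) * linearCoeff d y) (base x) := contDiffAt_const.mul hα
  have hpow (n : ℕ) : ContDiffAt ℝ 2 (fun t : ℝ => t ^ n) (height x) := by fun_prop
  have hexp : profile p d ε = fun x =>
      (fun y => ε ^ 2 * p y + ε ^ 4 * (p y * constCoeff p d y)) (base x)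
          * (fun t : ℝ => t ^ 0) (height x)
        + (fun y => ε * d y + ε ^ 3 * (d y * constCoeff p d y + p y * linearCoeff d y)) (base x)
          * (fun t : ℝ => t ^ 1) (height x)
        + (fun y => -1 + ε ^ 2 * (-(1 / 2) * Δ p y)) (base x) * (fun t : ℝ => t ^ 2) (height x)
        + (fun y => (-ε) * linearCoeff d y) (base x) * (fun t : ℝ => t ^ 3) (height x) := by
    funext x
    simp only [profile, constCoeff]
    ring
  have h0 := contDiffAt_base_mul_height hG0 (hpow 0)
  have h1 := contDiffAt_base_mul_height hG1 (hpow 1)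
  have h2 := contDiffAt_base_mul_height hG2 (hpow 2)
  have h3 := contDiffAt_base_mul_height hG3 (hpow 3)
  rw [hexp, laplacian_fun_add ((h0.add h1).add h2) h3, laplacian_fun_add (h0.add h1) h2,
    laplacian_fun_add h0 h1, laplacian_base_mul_height hG0 (hpow 0),
    laplacian_base_mul_height hG1 (hpow 1), laplacian_base_mul_height hG2 (hpow 2),
    laplacian_base_mul_height hG3 (hpow 3),
    laplacian_fun_add (contDiffAt_const.mul hp) (contDiffAt_const.mul hpβ),
    laplacian_fun_const_mul _ hp, laplacian_fun_const_mul _ hpβ,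
    laplacian_fun_add (contDiffAt_const.mul hd) (contDiffAt_const.mul hg1),
    laplacian_fun_const_mul _ hd, laplacian_fun_const_mul _ hg1,
    laplacian_fun_add contDiffAt_const (contDiffAt_const.mul hg2),
    laplacian_fun_const_mul _ hg2, laplacian_fun_const_mul _ hα]
  simp only [deriv_deriv_pow, residual, InnerProductSpace.laplacian_const, Pi.zero_apply]
  have hα' : linearCoeff d (base x) = 1 / 6 * Δ d (base x) := rfl
  rw [hα']
  norm_num
  ring

theorem exists_abs_le_on_closedBall {n : ℕ} {f : EuclideanSpace ℝ (Fin n) → ℝ}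
    {V : Set (EuclideanSpace ℝ (Fin n))} (hf : ContinuousOn f V) {y : EuclideanSpace ℝ (Fin n)}
    {r : ℝ} (hV : Metric.closedBall y r ⊆ V) :
    ∃ B, 0 ≤ B ∧ ∀ z ∈ Metric.closedBall y r, |f z| ≤ B := by
  obtain ⟨B, hB⟩ := (isCompact_closedBall y r).exists_bound_of_continuousOn (hf.mono hV)
  exact ⟨max B 0, le_max_right _ _, fun z hz => (hB z hz).trans (le_max_left _ _)⟩

/-- Every term of the residual carries `ε ^ j * height ^ k` with `j + k = 4`, and the height is
`O(ε)`. -/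
theorem exists_abs_residual_le {V : Set (EuclideanSpace ℝ (Fin m))} (hV : IsOpen V)
    (hp : ContDiffOn ℝ 2 p V) (hd : ContDiffOn ℝ 2 d V) (hΔp : ContDiffOn ℝ 2 (Δ p) V)
    (hΔd : ContDiffOn ℝ 2 (Δ d) V) {y : EuclideanSpace ℝ (Fin m)} {r : ℝ}
    (hball : Metric.closedBall y r ⊆ V) {L : ℝ} (hL : 0 ≤ L) :
    ∃ B, 0 ≤ B ∧ ∀ ε, 0 ≤ ε → ∀ x, base x ∈ Metric.closedBall y r → |height x| ≤ L * ε →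
      |residual p d ε x| ≤ B * ε ^ 4 := by
  have hcont {f : EuclideanSpace ℝ (Fin m) → ℝ} (hf : ContDiffOn ℝ 2 f V) :
      ContinuousOn (Δ f) V :=
    (contDiffOn_laplacian (l := 0) hV hf (by norm_num)).continuousOn
  have hα : ContDiffOn ℝ 2 (linearCoeff d) V := contDiffOn_const.mul hΔd
  have hβ : ContDiffOn ℝ 2 (constCoeff p d) V := (contDiffOn_const.mul hΔp).add (hd.mul hα)
  obtain ⟨B0, h0, hB0⟩ := exists_abs_le_on_closedBall
    (hcont (f := fun y => p y * constCoeff p d y) (hp.mul hβ)) hball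
  obtain ⟨B1, h1, hB1⟩ := exists_abs_le_on_closedBall
    (hcont (f := fun y => d y * constCoeff p d y + p y * linearCoeff d y)
      ((hd.mul hβ).add (hp.mul hα))) hball
  obtain ⟨B2, h2, hB2⟩ := exists_abs_le_on_closedBall
    (hcont (f := fun y => -(1 / 2) * Δ p y) (contDiffOn_const.mul hΔp)) hball
  obtain ⟨B3, h3, hB3⟩ := exists_abs_le_on_closedBall (hcont hα) hball
  refine ⟨B0 + B1 * L + B2 * L ^ 2 + B3 * L ^ 3, by positivity, fun ε hε x hx hz => ?_⟩
  have hterm (j k : ℕ) (hjk : j + k = 4) (c B : ℝ) (hc : |c| ≤ B) :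
      |ε ^ j * c * height x ^ k| ≤ B * L ^ k * ε ^ 4 := by
    have hB : 0 ≤ B := (abs_nonneg c).trans hc
    rw [abs_mul, abs_mul, abs_pow, abs_pow, abs_of_nonneg hε]
    calc ε ^ j * |c| * |height x| ^ k ≤ ε ^ j * B * (L * ε) ^ k := by gcongr
      _ = B * L ^ k * ε ^ 4 := by rw [← hjk]; ring
  have t0 := hterm 4 0 rfl _ _ (hB0 _ hx)
  have t1 := hterm 3 1 rfl _ _ (hB1 _ hx)
  have t2 := hterm 2 2 rfl _ _ (hB2 _ hx)
  have t3 := hterm 1 3 rfl _ _ (hB3 _ hx)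
  simp only [pow_zero, mul_one, pow_one] at t0 t1 t3
  rw [residual]
  rw [abs_le] at *
  constructor <;> linarith [t0.1, t0.2, t1.1, t1.2, t2.1, t2.2, t3.1, t3.2]

/-- Supplies the crude lateral data for the comparison of the profile with the torsion function. -/
theorem exists_abs_profile_le {V : Set (EuclideanSpace ℝ (Fin m))}
    (hp : ContinuousOn p V) (hd : ContinuousOn d V) (hΔp : ContinuousOn (Δ p) V)
    (hΔd : ContinuousOn (Δ d) V) {y : EuclideanSpace ℝ (Fin m)} {r : ℝ}
    (hball : Metric.closedBall y r ⊆ V) {L : ℝ} (hL : 0 ≤ L) :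
    ∃ B, 0 ≤ B ∧ ∀ ε, 0 ≤ ε → ε ≤ 1 → ∀ x, base x ∈ Metric.closedBall y r →
      |height x| ≤ L * ε → |profile p d ε x| ≤ B * ε ^ 2 := by
  have hα : ContinuousOn (linearCoeff d) V := continuousOn_const.mul hΔd
  have hβ : ContinuousOn (constCoeff p d) V := (continuousOn_const.mul hΔp).add (hd.mul hα)
  obtain ⟨P, hP0, hP⟩ := exists_abs_le_on_closedBall hp hball
  obtain ⟨D, hD0, hD⟩ := exists_abs_le_on_closedBall hd hball
  obtain ⟨A, hA0, hA⟩ := exists_abs_le_on_closedBall hα hball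
  obtain ⟨B, hB0, hB⟩ := exists_abs_le_on_closedBall hβ hball
  refine ⟨(P + D * L + L ^ 2) * (1 + B + A * L), by positivity, fun ε hε hε1 x hx hz => ?_⟩
  have hε2 : ε ^ 2 ≤ 1 := pow_le_one₀ hε hε1
  have h1 : |ε ^ 2 * p (base x) + ε * d (base x) * height x - height x ^ 2|
      ≤ (P + D * L + L ^ 2) * ε ^ 2 := by
    have a1 : |ε ^ 2 * p (base x)| ≤ ε ^ 2 * P := by
      rw [abs_mul, abs_of_nonneg (sq_nonneg ε)]
      exact mul_le_mul_of_nonneg_left (hP _ hx) (sq_nonneg ε)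
    have a2 : |ε * d (base x) * height x| ≤ ε * D * (L * ε) := by
      rw [abs_mul, abs_mul, abs_of_nonneg hε]
      have := hD _ hx
      gcongr
    have a3 : |height x ^ 2| ≤ (L * ε) ^ 2 := by
      rw [abs_pow]
      gcongr
    rw [abs_le] at a1 a2 a3 ⊢
    constructor <;> nlinarith
  have h2 : |1 + ε ^ 2 * constCoeff p d (base x) + ε * linearCoeff d (base x) * height x|
      ≤ 1 + B + A * L := by
    have a1 : |ε ^ 2 * constCoeff p d (base x)| ≤ 1 * B := by
      rw [abs_mul, abs_of_nonneg (sq_nonneg ε)]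
      have := hB _ hx
      gcongr
    have a2 : |ε * linearCoeff d (base x) * height x| ≤ 1 * A * (L * 1) := by
      rw [abs_mul, abs_mul, abs_of_nonneg hε]
      have := hA _ hx
      have : L * ε ≤ L * 1 := by gcongr
      have := hz.trans this
      gcongr
    rw [abs_le] at a1 a2 ⊢
    constructor <;> linarith [a1.1, a1.2, a2.1, a2.2]
  rw [profile, abs_mul]
  calc _ ≤ (P + D * L + L ^ 2) * ε ^ 2 * (1 + B + A * L) := by gcongr
    _ = _ := by ring

end Profile

/-- Near points over which the boundary of the thin domain is smooth, the torsion function is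
given by its two-term expansion up to an error of order `ε ^ 6`. -/
theorem exists_abs_sub_profile_le {m : ℕ} (hm : 1 ≤ m) {ω : Set (EuclideanSpace ℝ (Fin m))}
    (hω : IsOpen ω) (hωb : Bornology.IsBounded ω) {a b p d : EuclideanSpace ℝ (Fin m) → ℝ}
    (ha : ContinuousOn a (closure ω)) (hb : ContinuousOn b (closure ω)) {L : ℝ} (hL : 0 < L)
    (haL : ∀ y ∈ closure ω, |a y| ≤ L) (hbL : ∀ y ∈ closure ω, |b y| ≤ L)
    (hp : ∀ y, p y = b y * a y) (hd : ∀ y, d y = b y - a y)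
    {V : Set (EuclideanSpace ℝ (Fin m))} (hV : IsOpen V)
    (hpV : ContDiffOn ℝ 4 p V) (hdV : ContDiffOn ℝ 4 d V) {y₀ : EuclideanSpace ℝ (Fin m)} {r : ℝ}
    (hr : 0 < r) (hballV : Metric.closedBall y₀ r ⊆ V) (hballω : Metric.closedBall y₀ r ⊆ ω) :
    ∃ C, 0 ≤ C ∧ ∀ ε, 0 < ε → ε ≤ 1 → ∀ u, IsTorsionFunction (thinDomain ω a b ε) u →
      ∀ x ∈ thinDomain ω a b ε, dist (base x) y₀ ≤ r / 2 →
        |u x - profile p d ε x| ≤ C * ε ^ 6 := by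
  have hpV2 : ContDiffOn ℝ 2 p V := hpV.of_le (by norm_num)
  have hdV2 : ContDiffOn ℝ 2 d V := hdV.of_le (by norm_num)
  have hΔp : ContDiffOn ℝ 2 (Δ p) V := contDiffOn_laplacian hV hpV (by norm_num)
  have hΔd : ContDiffOn ℝ 2 (Δ d) V := contDiffOn_laplacian hV hdV (by norm_num)
  obtain ⟨B, hB0, hB⟩ := exists_abs_residual_le hV hpV2 hdV2 hΔp hΔd hballV hL.le
  obtain ⟨A, hA0, hA⟩ := exists_abs_profile_le hpV2.continuousOn hdV2.continuousOn
    hΔp.continuousOn hΔd.continuousOn hballV hL.le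
  refine ⟨B * L ^ 2 / 2 + (A + L ^ 2) * (96 * m ^ 5 * (L / (r / 2)) ^ 4), by positivity,
    fun ε hε hε1 u hu x hx hxr => ?_⟩
  set Ω := thinDomain ω a b ε with hΩdef
  have hΩ : IsOpen Ω := isOpen_thinDomain hω ha hb
  have hΩb : Bornology.IsBounded Ω := isBounded_thinDomain hωb ha hb hε.le haL hbL
  have hl : ∀ x ∈ closure Ω, |height x| ≤ L * ε := fun x hx =>
    abs_height_le_of_mem_closure ha hb hε.le haL hbL hx
  have hl0 : 0 < L * ε := by positivity
  -- The cylinder is centred at the point under study, which thus lies on its axis; the halved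
  -- radius keeps it over the ball of radius `r`.
  set U := cylinder Ω (base x) (r / 2) with hU
  have hsub : closure U ⊆ closure Ω := closure_cylinder_subset _ _ _
  have hUball : ∀ y ∈ closure U, base y ∈ Metric.closedBall y₀ r := by
    intro y hy
    have h1 := dist_base_le_of_mem_closure_cylinder hy
    have h2 := dist_triangle (base y) (base x) y₀
    rw [Metric.mem_closedBall]
    linarith
  have hvd : ∀ y ∈ closure U, ContDiffAt ℝ 2 (profile p d ε) y := by
    intro y hy
    have hn := hV.mem_nhds (hballV (hUball y hy))
    exact contDiffAt_profile (hpV2.contDiffAt hn) (hdV2.contDiffAt hn) (hΔp.contDiffAt hn)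
      (hΔd.contDiffAt hn)
  have hvU : ContDiffOn ℝ 2 (profile p d ε) U := fun y hy =>
    (hvd y (subset_closure hy)).contDiffWithinAt
  have hvc : ContinuousOn (profile p d ε) (closure U) := fun y hy =>
    (hvd y hy).continuousAt.continuousWithinAt
  have huU : ContDiffOn ℝ 2 u U := hu.contDiffOn.mono fun y hy => hy.1
  have huc : ContinuousOn u (closure U) := hu.continuousOn.mono hsub
  have hΔv : ∀ y ∈ U, |Δ (profile p d ε) y + 2| ≤ B * ε ^ 4 := by
    intro y hy
    have hyc := subset_closure hy
    have hn := hV.mem_nhds (hballV (hUball y hyc))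
    rw [laplacian_profile (hpV2.contDiffAt hn) (hdV2.contDiffAt hn) (hΔp.contDiffAt hn)
      (hΔd.contDiffAt hn)]
    have := hB ε hε.le y (hUball y hyc) (hl y (hsub hyc))
    rwa [show -2 + residual p d ε y + 2 = residual p d ε y by ring]
  have hv0 : ∀ y ∈ closure U, y ∉ Ω → profile p d ε y = 0 := by
    intro y hy hyn
    -- The factor is `(ε b - height) * (height + ε a)`, zero on top and bottom.
    have hfac : ε ^ 2 * p (base y) + ε * d (base y) * height y - height y ^ 2 = 0 := by
      rw [hp, hd]
      rcases height_eq_of_mem_closure_of_notMem ha hb (hsub hy) hyn (hballω (hUball y hy))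
        with h | h <;> rw [h] <;> ring
    rw [profile, hfac, zero_mul]
  have hvA : ∀ y ∈ closure U, |profile p d ε y| ≤ A * ε ^ 2 := fun y hy =>
    hA ε hε.le hε1 y (hUball y hy) (hl y (hsub hy))
  have hnn : ∀ y ∈ closure U, 0 ≤ u y := fun y hy => hu.nonneg hΩ hΩb (hsub hy)
  have hle : ∀ y ∈ closure U, u y ≤ (L * ε) ^ 2 := fun y hy => hu.le_sq hΩ hΩb hl (hsub hy)
  have hopen : IsOpen U := isOpen_cylinder hΩ _ _
  have hΔu : ∀ y ∈ U, Δ u y = -2 := fun y hy => by linarith [hu.neg_laplacian y hy.1]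
  have key1 := le_on_axis_of_laplacian_ge hm hΩ hΩb hl0 hl (half_pos hr)
    (w := fun y => u y - profile p d ε y) (K := B * ε ^ 4) (A := (A + L ^ 2) * ε ^ 2)
    (huU.sub hvU) (huc.sub hvc) (by positivity) (by positivity)
    (fun y hy => by
      rw [laplacian_fun_sub (huU.contDiffAt (hopen.mem_nhds hy)) (hvd y (subset_closure hy)),
        hΔu y hy]
      linarith [(abs_le.1 (hΔv y hy)).2])
    (fun y hy hyn => by simp [hv0 y hy hyn, hu.eq_zero hΩ (hsub hy) hyn])
    (fun y hy _ => by nlinarith [(abs_le.1 (hvA y hy)).1, hle y hy]) x hx rfl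
  have key2 := le_on_axis_of_laplacian_ge hm hΩ hΩb hl0 hl (half_pos hr)
    (w := fun y => profile p d ε y - u y) (K := B * ε ^ 4) (A := (A + L ^ 2) * ε ^ 2)
    (hvU.sub huU) (hvc.sub huc) (by positivity) (by positivity)
    (fun y hy => by
      rw [laplacian_fun_sub (hvd y (subset_closure hy)) (huU.contDiffAt (hopen.mem_nhds hy)),
        hΔu y hy]
      linarith [(abs_le.1 (hΔv y hy)).1])
    (fun y hy hyn => by simp [hv0 y hy hyn, hu.eq_zero hΩ (hsub hy) hyn])
    (fun y hy _ => by
      have : 0 ≤ L ^ 2 * ε ^ 2 := by positivity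
      linarith [(abs_le.1 (hvA y hy)).2, hnn y hy]) x hx rfl
  -- Source and lateral data both scale as `ε ^ 6`: the former as `ε ^ 4 * ε ^ 2`, the latter as `ε
  -- ^ 2 * ε ^ 4`.
  have heq : B * ε ^ 4 * (L * ε) ^ 2 / 2
      + (A + L ^ 2) * ε ^ 2 * (96 * m ^ 5 * (L * ε / (r / 2)) ^ 4)
      = (B * L ^ 2 / 2 + (A + L ^ 2) * (96 * m ^ 5 * (L / (r / 2)) ^ 4)) * ε ^ 6 := by
    field_simp
  rw [heq] at key1 key2
  rw [abs_le]
  constructor <;> linarith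

/-! ### Quadratic decay at a nondegenerate maximum -/

/-- Two monotonicity arguments: `ψ + 2 k t` is antitone and vanishes at `0`, hence `φ + k t ^ 2` is
antitone. -/
theorem le_sub_of_hasDerivAt {φ ψ χ : ℝ → ℝ} {k : ℝ}
    (hφ : ∀ t ∈ Set.Icc (0 : ℝ) 1, HasDerivAt φ (ψ t) t)
    (hψ : ∀ t ∈ Set.Icc (0 : ℝ) 1, HasDerivAt ψ (χ t) t)
    (hχ : ∀ t ∈ Set.Icc (0 : ℝ) 1, χ t ≤ -2 * k) (h0 : ψ 0 = 0) : φ 1 ≤ φ 0 - k := by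
  have hψ' : ∀ t ∈ Set.Icc (0 : ℝ) 1,
      HasDerivAt (fun t => ψ t + 2 * k * t) (χ t + 2 * k * 1) t := fun t ht =>
    (hψ t ht).add ((hasDerivAt_id t).const_mul (2 * k))
  have hφ' : ∀ t ∈ Set.Icc (0 : ℝ) 1,
      HasDerivAt (fun t => φ t + k * t ^ 2) (ψ t + k * (2 * t)) t := fun t ht =>
    ((hφ t ht).add ((hasDerivAt_pow 2 t).const_mul k)).congr_deriv (by simp)
  have h1 : AntitoneOn (fun t => ψ t + 2 * k * t) (Set.Icc 0 1) :=
    antitoneOn_of_hasDerivWithinAt_nonpos (convex_Icc 0 1)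
      (fun t ht => (hψ' t ht).continuousAt.continuousWithinAt)
      (fun t ht => (hψ' t (interior_subset ht)).hasDerivWithinAt)
      (fun t ht => by linarith [hχ t (interior_subset ht)])
  have h2 : AntitoneOn (fun t => φ t + k * t ^ 2) (Set.Icc 0 1) := by
    refine antitoneOn_of_hasDerivWithinAt_nonpos (convex_Icc 0 1)
      (fun t ht => (hφ' t ht).continuousAt.continuousWithinAt)
      (fun t ht => (hφ' t (interior_subset ht)).hasDerivWithinAt) (fun t ht => ?_)
    have ht' := interior_subset ht
    have := h1 (Set.left_mem_Icc.2 zero_le_one) ht' ht'.1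
    simp only [h0] at this
    linarith
  have := h2 (Set.left_mem_Icc.2 zero_le_one) (Set.right_mem_Icc.2 zero_le_one) zero_le_one
  simp only at this
  linarith

theorem eventually_norm_sub_lt {α F : Type*} [TopologicalSpace α] [NormedAddCommGroup F]
    {f : α → F} {x : α} (hf : ContinuousAt f x) {δ : ℝ} (hδ : 0 < δ) :
    ∀ᶠ y in nhds x, ‖f y - f x‖ < δ := by
  simpa [dist_eq_norm] using Metric.tendsto_nhds.1 hf.tendsto δ hδ

/-- Compactness of the unit sphere bounds the second derivative at `x` by `-c ‖e‖²`. Continuity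
keeps `-c / 2 ‖e‖²` nearby, and integrating twice along segments leaves `c / 4`. -/
theorem exists_le_sub_mul_dist_sq {n : ℕ} {f : EuclideanSpace ℝ (Fin n) → ℝ}
    {x : EuclideanSpace ℝ (Fin n)} (hf : ContDiffAt ℝ 2 f x) (hmax : IsLocalMax f x)
    (hneg : ∀ e, e ≠ 0 → fderiv ℝ (fderiv ℝ f) x e e < 0) :
    ∃ c, 0 < c ∧ ∀ᶠ y in nhds x, f y ≤ f x - c * dist y x ^ 2 := by
  set Q := fderiv ℝ (fderiv ℝ f) with hQ
  have hcontQ : ContinuousAt Q x :=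
    ((hf.fderiv_right (m := 1) (by norm_num)).fderiv_right (m := 0) (by norm_num)).continuousAt
  obtain ⟨c, hc, hcQ⟩ : ∃ c, 0 < c ∧ ∀ e ∈ Metric.sphere (0 : EuclideanSpace ℝ (Fin n)) 1,
      c ≤ -(Q x e e) := by
    refine (isCompact_sphere 0 1).exists_forall_le' ?_ fun e he => ?_
    · exact (((Q x).continuous.clm_apply continuous_id).neg).continuousOn
    · have : e ≠ 0 := by
        rintro rfl
        simp at he
      linarith [hneg e this]
  have hcQ' : ∀ e, c * ‖e‖ ^ 2 ≤ -(Q x e e) := by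
    intro e
    by_cases he : e = 0
    · simp [he]
    have hn : ‖e‖ ≠ 0 := norm_ne_zero_iff.2 he
    have h1 := hcQ (‖e‖⁻¹ • e) (by simp [norm_smul, hn])
    simp only [map_smul, smul_apply, smul_eq_mul] at h1
    have h2 := mul_le_mul_of_nonneg_right h1 (sq_nonneg ‖e‖)
    calc c * ‖e‖ ^ 2 ≤ _ := h2
      _ = -(Q x e e) := by field_simp
  have hnear : ∀ᶠ y in nhds x, ContDiffAt ℝ 2 f y ∧ ‖Q y - Q x‖ < c / 2 := by
    refine (hf.eventually (by simp)).and ?_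
    exact eventually_norm_sub_lt
      (F := EuclideanSpace ℝ (Fin n) →L[ℝ] EuclideanSpace ℝ (Fin n) →L[ℝ] ℝ) hcontQ (half_pos hc)
  obtain ⟨r, hr, hball⟩ := Metric.eventually_nhds_iff_ball.1 hnear
  refine ⟨c / 4, by positivity, Metric.eventually_nhds_iff_ball.2 ⟨r, hr, fun y hy => ?_⟩⟩
  set e := y - x with he
  have hseg : ∀ t ∈ Set.Icc (0 : ℝ) 1, x + t • e ∈ Metric.ball x r := by
    intro t ht
    rw [Metric.mem_ball, dist_eq_norm] at hy ⊢
    rw [add_sub_cancel_left, norm_smul, Real.norm_of_nonneg ht.1]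
    calc t * ‖e‖ ≤ 1 * ‖e‖ := by gcongr; exact ht.2
      _ < r := by rwa [one_mul]
  have hmain := le_sub_of_hasDerivAt (φ := fun t => f (x + t • e))
    (ψ := fun t => fderiv ℝ f (x + t • e) e) (χ := fun t => Q (x + t • e) e e)
    (k := c / 4 * ‖e‖ ^ 2)
    (fun t ht => hasDerivAt_comp_line
      ((hball _ (hseg t ht)).1.differentiableAt (by norm_num)))
    (fun t ht => hasDerivAt_fderiv_comp_line (hball _ (hseg t ht)).1)
    (fun t ht => by
      have h1 := (hball _ (hseg t ht)).2
      have h2 : ‖(Q (x + t • e) - Q x) e e‖ ≤ c / 2 * ‖e‖ * ‖e‖ :=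
        (ContinuousLinearMap.le_opNorm₂ _ e e).trans (by gcongr)
      have h3 := (abs_le.1 ((Real.norm_eq_abs _).symm.le.trans h2)).2
      simp only [sub_apply] at h3
      have h4 := hcQ' e
      nlinarith)
    (by simp [hmax.fderiv_eq_zero])
  simpa [he, dist_eq_norm] using hmain

theorem fderiv_fderiv_neg_of_posDef {m : ℕ} {f : EuclideanSpace ℝ (Fin m) → ℝ}
    {x : EuclideanSpace ℝ (Fin m)} (hf : ContDiffAt ℝ 2 f x) (hpd : (-hessian f x).PosDef)
    (e : EuclideanSpace ℝ (Fin m)) (he : e ≠ 0) : fderiv ℝ (fderiv ℝ f) x e e < 0 := by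
  have h1 := hpd.dotProduct_mulVec_pos (x := WithLp.ofLp e) (by simpa using he)
  have h2 : e = ∑ i, e i • EuclideanSpace.single i (1 : ℝ) := by
    ext j
    simp [Finset.sum_apply, Pi.single_apply]
  have h3 : fderiv ℝ (fderiv ℝ f) x e e = ∑ i, e i * ∑ j, hessian f x i j * e j := by
    conv_lhs => rw [h2]
    simp only [map_sum, map_smul, sum_apply, smul_apply,
      smul_eq_mul, hessian_apply hf]
    simp only [Finset.mul_sum]
    rw [Finset.sum_comm]
    refine Finset.sum_congr rfl fun i _ => ?_
    refine Finset.sum_congr rfl fun j _ => ?_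
    ring
  rw [Matrix.neg_mulVec, dotProduct_neg] at h1
  simp only [dotProduct, Matrix.mulVec, Pi.star_apply,
    star_trivial] at h1
  rw [h3]
  linarith

/-! ### Bounds away from the maximum of `H` -/

/-- Outside the ball, `closure ω` is compact and `H` stays strictly below its maximum: by uniqueness
inside `ω`, and since `H` vanishes on the rest. -/
theorem exists_forall_le_sub {m : ℕ} {ω : Set (EuclideanSpace ℝ (Fin m))}
    (hωb : Bornology.IsBounded ω) {H : EuclideanSpace ℝ (Fin m) → ℝ}
    (hH : ContinuousOn H (closure ω)) {x : EuclideanSpace ℝ (Fin m)} (hx : 0 < H x)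
    (hbd : ∀ y ∈ closure ω, y ∉ ω → H y = 0) (hmax : IsMaxOn H ω x)
    (huniq : ∀ y ∈ ω, IsMaxOn H ω y → y = x) {r : ℝ} (hr : 0 < r) :
    ∃ η, 0 < η ∧ η ≤ H x ∧ ∀ y ∈ ω, r ≤ dist y x → H y ≤ H x - η := by
  have hK : IsCompact (closure ω ∩ {y | r ≤ dist y x}) :=
    hωb.isCompact_closure.inter_right
      (isClosed_le continuous_const (continuous_id.dist continuous_const))
  obtain ⟨η, hη, h⟩ := hK.exists_forall_le' (f := fun y => H x - H y) (a := 0)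
    (continuousOn_const.sub (hH.mono Set.inter_subset_left)) (by
      rintro y ⟨hy, hyr⟩
      by_cases hyω : y ∈ ω
      · refine sub_pos.2 (lt_of_le_of_ne (hmax hyω) fun heq => ?_)
        have hyx : y = x := huniq y hyω fun z hz => (hmax hz).trans_eq heq.symm
        rw [Set.mem_ofPred_eq, hyx, dist_self] at hyr
        linarith
      · simpa [hbd y hy hyω] using hx)
  refine ⟨min η (H x), lt_min hη hx, min_le_right _ _, fun y hy hyr => ?_⟩
  have h1 := h y ⟨subset_closure hy, hyr⟩
  have h2 := min_le_left η (H x)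
  linarith

/-- By uniform continuity, over a ball of radius independent of `ε` and of the point, the domain
fits in a strip whose width exceeds the fibre's by `ε η / 2`. Half of the gap `η` survives. -/
theorem exists_torsion_le_of_le_sub {m : ℕ} (hm : 1 ≤ m) {ω : Set (EuclideanSpace ℝ (Fin m))}
    (hω : IsOpen ω) (hωb : Bornology.IsBounded ω) {a b : EuclideanSpace ℝ (Fin m) → ℝ}
    (ha : ContinuousOn a (closure ω)) (hb : ContinuousOn b (closure ω)) {L : ℝ} (hL : 0 < L)
    (haL : ∀ y ∈ closure ω, |a y| ≤ L) (hbL : ∀ y ∈ closure ω, |b y| ≤ L)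
    (hpos : ∀ y ∈ ω, 0 < a y + b y) {h η : ℝ} (hη : 0 < η) :
    ∃ K, 0 ≤ K ∧ ∀ ε, 0 < ε → ∀ u, IsTorsionFunction (thinDomain ω a b ε) u →
      ∀ x ∈ thinDomain ω a b ε, a (base x) + b (base x) ≤ h - η →
        u x ≤ ε ^ 2 * (h - η / 2) ^ 2 / 4 + K * ε ^ 6 := by
  have hcomp := hωb.isCompact_closure
  obtain ⟨ρ₁, hρ₁, h₁⟩ := Metric.uniformContinuousOn_iff.1
    (hcomp.uniformContinuousOn_of_continuous ha) (η / 4) (by positivity)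
  obtain ⟨ρ₂, hρ₂, h₂⟩ := Metric.uniformContinuousOn_iff.1
    (hcomp.uniformContinuousOn_of_continuous hb) (η / 4) (by positivity)
  set ρ := min ρ₁ ρ₂ / 2 with hρdef
  have hρ : 0 < ρ := by positivity
  have hρ₁' : ρ < ρ₁ := by linarith [min_le_left ρ₁ ρ₂]
  have hρ₂' : ρ < ρ₂ := by linarith [min_le_right ρ₁ ρ₂]
  refine ⟨L ^ 2 * (96 * m ^ 5 * (L / ρ) ^ 4), by positivity, fun ε hε u hu x hx hxη => ?_⟩
  have hΩ : IsOpen (thinDomain ω a b ε) := isOpen_thinDomain hω ha hb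
  have hΩb := isBounded_thinDomain hωb ha hb hε.le haL hbL
  have hxω : base x ∈ closure ω := subset_closure hx.1
  have hstrip := hu.le_strip hm hΩ hΩb (l := L * ε) (by positivity)
    (fun x hx => abs_height_le_of_mem_closure ha hb hε.le haL hbL hx) (x₀ := base x) (ρ := ρ)
    (α := ε * (a (base x) + η / 4)) (β := ε * (b (base x) + η / 4)) hρ (by
      intro y hy
      have hd := dist_base_le_of_mem_closure_cylinder hy
      obtain ⟨hyω, hy1, hy2⟩ := mem_closure_thinDomain ha hb (closure_cylinder_subset _ _ _ hy)
      have e1 := h₁ _ hyω _ hxω (hd.trans_lt hρ₁')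
      have e2 := h₂ _ hyω _ hxω (hd.trans_lt hρ₂')
      rw [Real.dist_eq, abs_lt] at e1 e2
      have e3 : ε * a (base y) ≤ ε * (a (base x) + η / 4) :=
        mul_le_mul_of_nonneg_left (by linarith [e1.2]) hε.le
      have e4 : ε * b (base y) ≤ ε * (b (base x) + η / 4) :=
        mul_le_mul_of_nonneg_left (by linarith [e2.2]) hε.le
      constructor <;> linarith) hx rfl
  refine hstrip.trans (add_le_add ?_ (le_of_eq ?_))
  · have h3 := hpos _ hx.1
    have h4 : (a (base x) + b (base x) + η / 2) ^ 2 ≤ (h - η / 2) ^ 2 :=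
      pow_le_pow_left₀ (by linarith) (by linarith) 2
    have h5 := mul_le_mul_of_nonneg_left h4 (sq_nonneg ε)
    nlinarith
  · field_simp

/-! ### The maximum of the approximate solution -/

/-- Measuring the height from the fibre's midpoint `ε d / 2` turns the main factor into its fibre
maximum minus a square. -/
theorem profile_eq {m : ℕ} {a b p d : EuclideanSpace ℝ (Fin m) → ℝ}
    (hp : ∀ y, p y = b y * a y) (hd : ∀ y, d y = b y - a y) (ε : ℝ)
    (x : EuclideanSpace ℝ (Fin (m + 1))) :
    profile p d ε x =
      (ε ^ 2 * (a (base x) + b (base x)) ^ 2 / 4 - (height x - ε * d (base x) / 2) ^ 2) *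
      (1 + ε ^ 2 * (constCoeff p d (base x) + d (base x) / 2 * linearCoeff d (base x))
        + ε * linearCoeff d (base x) * (height x - ε * d (base x) / 2)) := by
  rw [profile]
  congr 1
  · rw [hp, hd]; ring
  · ring

/-- The factor `1 + ε² γ₀ ≥ 1 / 2` preserves half of the quadratic loss `ε² c δ² + σ²`. That half
absorbs the gains linear in `δ` and `|σ|` by completing squares, at cost `ε ^ 6`. -/
theorem mul_one_add_le_of_quadratic_decay {ε h c δ σ γ γ₀ α G A q : ℝ} (hε : 0 < ε) (hc : 0 < c)
    (hδ : 0 ≤ δ) (hq0 : 0 ≤ q) (hq : q ≤ ε ^ 2 * (h - c * δ ^ 2) - σ ^ 2)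
    (hγ : γ ≤ γ₀ + G * δ) (hα : |α| ≤ A) (hG : 0 ≤ G) (hγ₀ : ε ^ 2 * |γ₀| ≤ 1 / 2) :
    q * (1 + ε ^ 2 * γ + ε * α * σ) ≤
      ε ^ 2 * h * (1 + ε ^ 2 * γ₀) + ((h * G) ^ 2 / (2 * c) + (h * A) ^ 2 / 2) * ε ^ 6 := by
  have hA : 0 ≤ A := (abs_nonneg α).trans hα
  have hε2 : 0 < ε ^ 2 := by positivity
  have hασ : α * σ ≤ A * |σ| := by
    calc α * σ ≤ |α * σ| := le_abs_self _
      _ = |α| * |σ| := abs_mul _ _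
      _ ≤ A * |σ| := by gcongr
  have hlow : 1 / 2 ≤ 1 + ε ^ 2 * γ₀ := by
    have := mul_le_mul_of_nonneg_left (neg_abs_le γ₀) hε2.le
    linarith
  have hqh : q ≤ ε ^ 2 * h := by
    have : 0 ≤ ε ^ 2 * (c * δ ^ 2) := by positivity
    nlinarith [sq_nonneg σ]
  have h1 : q * (1 + ε ^ 2 * γ + ε * α * σ)
      ≤ q * (1 + ε ^ 2 * γ₀) + q * (ε ^ 2 * (G * δ) + ε * (A * |σ|)) := by
    rw [← mul_add]
    refine mul_le_mul_of_nonneg_left ?_ hq0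
    have e1 := mul_le_mul_of_nonneg_left hγ hε2.le
    have e2 := mul_le_mul_of_nonneg_left hασ hε.le
    linarith
  have h2 : q * (1 + ε ^ 2 * γ₀)
      ≤ ε ^ 2 * h * (1 + ε ^ 2 * γ₀) - (ε ^ 2 * (c * δ ^ 2) + σ ^ 2) / 2 := by
    have e1 := mul_le_mul_of_nonneg_right hq (by linarith : 0 ≤ 1 + ε ^ 2 * γ₀)
    have e2 : 0 ≤ ε ^ 2 * (c * δ ^ 2) + σ ^ 2 := by positivity
    have e3 := mul_le_mul_of_nonneg_left hlow e2
    linarith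
  have h3 : q * (ε ^ 2 * (G * δ) + ε * (A * |σ|))
      ≤ ε ^ 2 * h * (ε ^ 2 * (G * δ) + ε * (A * |σ|)) :=
    mul_le_mul_of_nonneg_right hqh (by positivity)
  have h4 : ε ^ 4 * (h * G * δ) ≤ ε ^ 2 * (c * δ ^ 2) / 2 + (h * G) ^ 2 / (2 * c) * ε ^ 6 := by
    have e1 : 0 ≤ ε ^ 2 / (2 * c) * (c * δ - h * G * ε ^ 2) ^ 2 := by positivity
    have e2 : ε ^ 2 / (2 * c) * (c * δ - h * G * ε ^ 2) ^ 2
        = ε ^ 2 * (c * δ ^ 2) / 2 + (h * G) ^ 2 / (2 * c) * ε ^ 6 - ε ^ 4 * (h * G * δ) := by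
      field_simp
      ring
    linarith
  have h5 : ε ^ 3 * (h * A * |σ|) ≤ σ ^ 2 / 2 + (h * A) ^ 2 / 2 * ε ^ 6 := by
    rw [← sq_abs σ]
    nlinarith [sq_nonneg (|σ| - h * A * ε ^ 3)]
  nlinarith

/-- A maximum over the compact closure has positive value, hence cannot sit where `u` vanishes. -/
theorem IsTorsionFunction.exists_isMaxOn {n : ℕ} {Ω : Set (EuclideanSpace ℝ (Fin n))}
    {u : EuclideanSpace ℝ (Fin n) → ℝ} (hu : IsTorsionFunction Ω u) (hΩ : IsOpen Ω)
    (hΩb : Bornology.IsBounded Ω) {x : EuclideanSpace ℝ (Fin n)} (hx : x ∈ Ω) (hpos : 0 < u x) :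
    ∃ z ∈ Ω, ∀ y ∈ Ω, u y ≤ u z := by
  obtain ⟨z, hz, hmax⟩ := hΩb.isCompact_closure.exists_isMaxOn ⟨x, subset_closure hx⟩
    hu.continuousOn
  refine ⟨z, ?_, fun y hy => hmax (subset_closure hy)⟩
  by_contra hzn
  have h1 : u x ≤ u z := hmax (subset_closure hx)
  rw [hu.eq_zero hΩ hz hzn] at h1
  linarith

theorem exists_base_height_eq {m : ℕ} (y : EuclideanSpace ℝ (Fin m)) (t : ℝ) :
    ∃ x : EuclideanSpace ℝ (Fin (m + 1)), base x = y ∧ height x = t := by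
  refine ⟨WithLp.toLp 2 (Fin.snoc (α := fun _ => ℝ) (fun i => y i) t), ?_, ?_⟩
  · ext i
    simp [base]
  · simp [height]

theorem exists_profile_le {m : ℕ} {ω : Set (EuclideanSpace ℝ (Fin m))}
    {a b p d : EuclideanSpace ℝ (Fin m) → ℝ} (hp : ∀ y, p y = b y * a y)
    (hd : ∀ y, d y = b y - a y) (hpos : ∀ y ∈ ω, 0 < a y + b y) {y₀ : EuclideanSpace ℝ (Fin m)}
    (hy₀ : y₀ ∈ ω) (hd2 : ContDiffAt ℝ 2 d y₀)
    (hΔp : ContDiffAt ℝ 2 (Δ p) y₀) (hΔd : ContDiffAt ℝ 2 (Δ d) y₀) {c : ℝ} (hc : 0 < c)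
    (hquad : ∀ᶠ y in nhds y₀, a y + b y ≤ a y₀ + b y₀ - c * dist y y₀ ^ 2) :
    ∃ C, 0 ≤ C ∧ ∀ᶠ y in nhds y₀, ∀ ε, 0 < ε →
      ε ^ 2 * |constCoeff p d y₀ + d y₀ / 2 * linearCoeff d y₀| ≤ 1 / 2 →
      ∀ x ∈ thinDomain ω a b ε, base x = y → profile p d ε x ≤
        ε ^ 2 * ((a y₀ + b y₀) ^ 2 / 4) *
          (1 + ε ^ 2 * (constCoeff p d y₀ + d y₀ / 2 * linearCoeff d y₀)) + C * ε ^ 6 := by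
  set γ : EuclideanSpace ℝ (Fin m) → ℝ :=
    fun y => constCoeff p d y + d y / 2 * linearCoeff d y with hγ
  have hα := contDiffAt_linearCoeff hΔd
  have hγd : ContDiffAt ℝ 2 γ y₀ :=
    (contDiffAt_constCoeff hd2 hΔp hΔd).add ((hd2.div_const 2).mul hα)
  obtain ⟨G, t, ht, hG⟩ := (hγd.of_le (by norm_num : (1 : WithTop ℕ∞) ≤ 2)).exists_lipschitzOnWith
  set A : ℝ := |linearCoeff d y₀| + 1 with hA
  have hαA : ∀ᶠ y in nhds y₀, |linearCoeff d y| ≤ A := by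
    have := hα.continuousAt.abs.eventually_lt continuousAt_const
      (show |linearCoeff d y₀| < A by simp [hA])
    exact this.mono fun y hy => hy.le
  set H₀ := a y₀ + b y₀ with hH₀
  have hH₀pos : 0 < H₀ := hpos y₀ hy₀
  -- The absorption estimate is used with `h = H₀ ^ 2 / 4` and decay rate `c * H₀ / 4`; `G` is a
  -- local Lipschitz constant of `γ`.
  refine ⟨(H₀ ^ 2 / 4 * G) ^ 2 / (2 * (c * H₀ / 4)) + (H₀ ^ 2 / 4 * A) ^ 2 / 2, by positivity, ?_⟩
  filter_upwards [ht, hαA, hquad] with y hyt hyα hyq ε hε hε2 x hx hxy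
  subst hxy
  rw [profile_eq hp hd]
  obtain ⟨hxω, hx1, hx2⟩ := hx
  have hHx := hpos _ hxω
  refine mul_one_add_le_of_quadratic_decay hε (by positivity)
    (dist_nonneg (x := base x) (y := y₀)) ?_ ?_ ?_ hyα G.2 hε2
  · rw [hd]
    nlinarith [mul_pos (sub_pos.2 hx1) (sub_pos.2 hx2)]
  · have h1 : (a (base x) + b (base x)) ^ 2 ≤ H₀ * (H₀ - c * dist (base x) y₀ ^ 2) := by
      rw [sq]
      refine mul_le_mul ?_ hyq hHx.le hH₀pos.le
      have : 0 ≤ c * dist (base x) y₀ ^ 2 := by positivity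
      linarith
    have h2 := mul_le_mul_of_nonneg_left h1 (sq_nonneg ε)
    linarith
  · have h1 := hG.dist_le_mul _ hyt _ (mem_of_mem_nhds ht)
    rw [Real.dist_eq] at h1
    have h2 := (le_abs_self _).trans h1
    simp only [hγ] at h2
    linarith

theorem eventually_mul_sq_lt (K : ℝ) {g : ℝ} (hg : 0 < g) :
    ∀ᶠ ε in nhds (0 : ℝ), K * ε ^ 2 < g := by
  have h : ContinuousAt (fun ε : ℝ => K * ε ^ 2) 0 := by fun_prop
  exact h.eventually_lt continuousAt_const (by simpa using hg)

end ThinDomain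

/-! ### The expansion of the maximum -/

open ThinDomain in
theorem theorem2p1 {m : ℕ} (hm : 1 ≤ m)
    -- the base domain `ω`
    (ω : Set (EuclideanSpace ℝ (Fin m)))
    (hω_open : IsOpen ω) (hω_conn : IsConnected ω) (hω_bdd : Bornology.IsBounded ω)
    (hω_C1 : ThinDomain.HasC1Boundary ω)
    -- the functions `h₋`, `h₊`, and `H = h₋ + h₊`, `d = h₊ - h₋`, `p = h₊ h₋`
    (hMinus hPlus H d p : EuclideanSpace ℝ (Fin m) → ℝ)
    (hMinus_cont : ContinuousOn hMinus (closure ω)) (hMinus_C1 : ContDiffOn ℝ 1 hMinus ω)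
    (hPlus_cont : ContinuousOn hPlus (closure ω)) (hPlus_C1 : ContDiffOn ℝ 1 hPlus ω)
    (hH : ∀ x, H x = hMinus x + hPlus x)
    (hd : ∀ x, d x = hPlus x - hMinus x)
    (hp : ∀ x, p x = hPlus x * hMinus x)
    (hH_pos : ∀ x ∈ ω, 0 < H x) (hH_bdry : ∀ x ∈ frontier ω, H x = 0)
    -- H1: `H` attains its global maximum `H₀` at exactly one point `xbar` of `ω`
    (xbar : EuclideanSpace ℝ (Fin m)) (hxbar : xbar ∈ ω) (hmax : IsMaxOn H ω xbar)
    (hmax_unique : ∀ y ∈ ω, IsMaxOn H ω y → y = xbar)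
    (H₀ : ℝ) (hH₀ : H₀ = H xbar)
    -- H2: the Hessian matrix `2 H₂` of `H` at `xbar` is negative definite
    (H₂ : Matrix (Fin m) (Fin m) ℝ) (hH₂ : (2 : ℝ) • H₂ = ThinDomain.hessian H xbar)
    (hH₂_neg : (-((2 : ℝ) • H₂)).PosDef)
    -- H3: `h₋` and `h₊` are five times continuously differentiable in a neighbourhood of `xbar`
    (V : Set (EuclideanSpace ℝ (Fin m))) (hV_open : IsOpen V) (hxbar_V : xbar ∈ V)
    (hMinus_C5 : ContDiffOn ℝ 5 hMinus V) (hPlus_C5 : ContDiffOn ℝ 5 hPlus V)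
    -- `d₀ = d xbar`, and `2 D₂`, `2 P₂` are the Hessian matrices of `d`, `p` at `xbar`
    (d₀ : ℝ) (hd₀ : d₀ = d xbar)
    (D₂ P₂ : Matrix (Fin m) (Fin m) ℝ)
    (hD₂ : (2 : ℝ) • D₂ = ThinDomain.hessian d xbar)
    (hP₂ : (2 : ℝ) • P₂ = ThinDomain.hessian p xbar) :
    ∃ C ε₀ : ℝ, 0 < C ∧ 0 < ε₀ ∧ ∀ ε : ℝ, 0 < ε → ε < ε₀ →
      ∀ u : EuclideanSpace ℝ (Fin (m + 1)) → ℝ,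
        ThinDomain.IsTorsionFunction (ThinDomain.thinDomain ω hMinus hPlus ε) u →
        ∃ M : ℝ, IsGreatest (u '' ThinDomain.thinDomain ω hMinus hPlus ε) M ∧
          |M - (1 / 4 * H₀ ^ 2 * ε ^ 2
              + 1 / 8 * H₀ ^ 2 * (d₀ * D₂.trace + 2 * P₂.trace) * ε ^ 4)| ≤ C * ε ^ 5 := by
  have hH_eq : H = fun y => hMinus y + hPlus y := funext hH
  have hd_eq : d = fun y => hPlus y - hMinus y := funext hd
  have hp_eq : p = fun y => hPlus y * hMinus y := funext hp
  have hVn : V ∈ nhds xbar := hV_open.mem_nhds hxbar_V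
  have hHV : ContDiffOn ℝ 5 H V := by rw [hH_eq]; exact hMinus_C5.add hPlus_C5
  have hdV : ContDiffOn ℝ 5 d V := by rw [hd_eq]; exact hPlus_C5.sub hMinus_C5
  have hpV : ContDiffOn ℝ 5 p V := by rw [hp_eq]; exact hPlus_C5.mul hMinus_C5
  have hdV4 : ContDiffOn ℝ 4 d V := hdV.of_le (by norm_num)
  have hpV4 : ContDiffOn ℝ 4 p V := hpV.of_le (by norm_num)
  have hΔp : ContDiffAt ℝ 2 (Δ p) xbar :=
    (contDiffOn_laplacian hV_open hpV4 (by norm_num)).contDiffAt hVn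
  have hΔd : ContDiffAt ℝ 2 (Δ d) xbar :=
    (contDiffOn_laplacian hV_open hdV4 (by norm_num)).contDiffAt hVn
  have hH2 : ContDiffAt ℝ 2 H xbar := (hHV.contDiffAt hVn).of_le (by norm_num)
  have hd2 : ContDiffAt ℝ 2 d xbar := (hdV.contDiffAt hVn).of_le (by norm_num)
  have hp2 : ContDiffAt ℝ 2 p xbar := (hpV.contDiffAt hVn).of_le (by norm_num)
  have hHc : ContinuousOn H (closure ω) := by rw [hH_eq]; exact hMinus_cont.add hPlus_cont
  have hpos : ∀ y ∈ ω, 0 < hMinus y + hPlus y := fun y hy => by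
    rw [← hH]; exact hH_pos y hy
  have hH₀pos : 0 < H₀ := by rw [hH₀]; exact hH_pos xbar hxbar
  have hH₀' : hMinus xbar + hPlus xbar = H₀ := by rw [hH₀, hH]
  -- a common bound for `h₋` and `h₊`
  obtain ⟨L, hL, hLm, hLp⟩ : ∃ L, 0 < L ∧ (∀ y ∈ closure ω, |hMinus y| ≤ L) ∧
      ∀ y ∈ closure ω, |hPlus y| ≤ L := by
    obtain ⟨L₁, h₁⟩ := hω_bdd.isCompact_closure.exists_bound_of_continuousOn hMinus_cont
    obtain ⟨L₂, h₂⟩ := hω_bdd.isCompact_closure.exists_bound_of_continuousOn hPlus_cont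
    refine ⟨max (max L₁ L₂) 1, by positivity, fun y hy => ?_, fun y hy => ?_⟩
    · exact (h₁ y hy).trans ((le_max_left _ _).trans (le_max_left _ _))
    · exact (h₂ y hy).trans ((le_max_right _ _).trans (le_max_left _ _))
  -- quadratic decay of `H` near its maximum point
  have hloc : IsLocalMax H xbar := by
    filter_upwards [hω_open.mem_nhds hxbar] with y hy using hmax hy
  rw [hH₂] at hH₂_neg
  obtain ⟨c, hc, hquad⟩ := exists_le_sub_mul_dist_sq hH2 hloc
    (fderiv_fderiv_neg_of_posDef hH2 hH₂_neg)
  simp only [hH] at hquad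
  obtain ⟨C₂, hC₂, hprof⟩ := exists_profile_le hp hd hpos hxbar hd2 hΔp hΔd hc hquad
  obtain ⟨R, hR, hRball⟩ := Metric.eventually_nhds_iff_ball.1
    (hprof.and (Filter.inter_mem hVn (hω_open.mem_nhds hxbar)))
  set r := R / 2 with hr
  have hr0 : 0 < r := by positivity
  have hcb : Metric.closedBall xbar r ⊆ Metric.ball xbar R :=
    Metric.closedBall_subset_ball (by linarith)
  obtain ⟨C₁, hC₁, happrox⟩ := exists_abs_sub_profile_le hm hω_open hω_bdd hMinus_cont hPlus_cont
    hL hLm hLp hp hd hV_open hpV4 hdV4 hr0 (fun y hy => (hRball y (hcb hy)).2.1)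
    (fun y hy => (hRball y (hcb hy)).2.2)
  -- the region away from the maximum point
  obtain ⟨η, hη, hηH, hgap⟩ := exists_forall_le_sub hω_bdd hHc (hH_pos xbar hxbar)
    (fun y hy hyn => hH_bdry y ⟨hy, by rwa [hω_open.interior_eq]⟩) hmax hmax_unique (half_pos hr0)
  rw [← hH₀] at hηH hgap
  obtain ⟨K, hK, haway⟩ := exists_torsion_le_of_le_sub hm hω_open hω_bdd hMinus_cont hPlus_cont
    hL hLm hLp hpos (h := H₀) hη
  -- the leading coefficients
  set γ₀ := constCoeff p d xbar + d xbar / 2 * linearCoeff d xbar with hγ₀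
  -- Here `γ₀ = Δp / 2 + d Δd / 4` at `xbar`, and each Laplacian is twice the corresponding trace.
  have hcoeff : 1 / 4 * H₀ ^ 2 * γ₀ = 1 / 8 * H₀ ^ 2 * (d₀ * D₂.trace + 2 * P₂.trace) := by
    have h1 : 2 * D₂.trace = Δ d xbar := by
      rw [← trace_hessian hd2, ← hD₂, Matrix.trace_smul, smul_eq_mul]
    have h2 : 2 * P₂.trace = Δ p xbar := by
      rw [← trace_hessian hp2, ← hP₂, Matrix.trace_smul, smul_eq_mul]
    rw [hγ₀, constCoeff, linearCoeff, ← h1, ← h2, hd₀]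
    ring
  rw [hH₀'] at hRball
  -- The gap between the `ε ^ 2` coefficients near and away from `xbar`.
  set g := (H₀ ^ 2 - (H₀ - η / 2) ^ 2) / 4 with hg
  have hg0 : 0 < g := by
    have : H₀ ^ 2 - (H₀ - η / 2) ^ 2 = η / 2 * (2 * H₀ - η / 2) := by ring
    rw [hg, this]
    have : 0 < 2 * H₀ - η / 2 := by linarith
    positivity
  -- In order: the correction factor stays at least `1 / 2`; the lower bound for the maximum is
  -- positive; the gap `g` beats the higher-order terms away from `xbar`; and `ε < 1`.
  have hsmall := ((eventually_mul_sq_lt |γ₀| (by norm_num : (0 : ℝ) < 1 / 2)).and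
    (eventually_mul_sq_lt C₁ (by positivity : 0 < H₀ ^ 2 / 8))).and
    ((eventually_mul_sq_lt (K + H₀ ^ 2 / 4 * |γ₀|) hg0).and
    (eventually_mul_sq_lt 1 one_pos))
  obtain ⟨ε₀, hε₀, hball⟩ := Metric.eventually_nhds_iff_ball.1 hsmall
  -- `C₁` is the approximation error and `C₂` the error in maximising the profile; the `1` only
  -- makes the constant positive. Both errors are of order `ε ^ 6`, weakened to `ε ^ 5` at the end.
  refine ⟨C₁ + C₂ + 1, ε₀, by positivity, hε₀, fun ε hε hεε₀ u hu => ?_⟩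
  obtain ⟨⟨s1, s2⟩, s3, s4⟩ := hball ε (by rwa [Metric.mem_ball, Real.dist_eq, sub_zero,
    abs_of_pos hε])
  have hε1 : ε ≤ 1 := by nlinarith
  set X := 1 / 4 * H₀ ^ 2 * ε ^ 2 + 1 / 8 * H₀ ^ 2 * (d₀ * D₂.trace + 2 * P₂.trace) * ε ^ 4 with hX
  have hX' : X = ε ^ 2 * (H₀ ^ 2 / 4) * (1 + ε ^ 2 * γ₀) := by
    rw [hX, ← hcoeff]; ring
  have hε2 : 0 < ε ^ 2 := by positivity
  have hγlow : -(1 / 2) ≤ ε ^ 2 * γ₀ := by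
    have := mul_le_mul_of_nonneg_left (neg_abs_le γ₀) hε2.le
    linarith
  have hε64 : ε ^ 6 ≤ ε ^ 4 := pow_le_pow_of_le_one hε.le hε1 (by norm_num)
  have hε65 : ε ^ 6 ≤ ε ^ 5 := pow_le_pow_of_le_one hε.le hε1 (by norm_num)
  have hΩ : IsOpen (thinDomain ω hMinus hPlus ε) := isOpen_thinDomain hω_open hMinus_cont hPlus_cont
  have hΩb := isBounded_thinDomain hω_bdd hMinus_cont hPlus_cont hε.le hLm hLp
  -- the value at the centre of the fibre over the maximum point
  obtain ⟨xs, hxs1, hxs2⟩ := exists_base_height_eq xbar (ε * d xbar / 2)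
  have hxsΩ : xs ∈ thinDomain ω hMinus hPlus ε := by
    have := mul_pos hε (hpos xbar hxbar)
    refine ⟨by rwa [hxs1], ?_, ?_⟩ <;> rw [hxs1, hxs2, hd] <;> linarith
  have hxsX : profile p d ε xs = X := by
    rw [profile_eq hp hd, hxs1, hxs2, hX', ← hH₀']
    ring
  have hlow : X - C₁ * ε ^ 6 ≤ u xs := by
    have := (abs_le.1 (happrox ε hε hε1 u hu xs hxsΩ (by simp [hxs1, (half_pos hr0).le]))).1
    linarith
  have hXpos : 0 < X - C₁ * ε ^ 6 := by
    have h1 : ε ^ 2 * (H₀ ^ 2 / 4) * (1 / 2) ≤ X := by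
      rw [hX']
      exact mul_le_mul_of_nonneg_left (by linarith) (by positivity)
    have h2 := mul_lt_mul_of_pos_left s2 hε2
    have h3 := mul_le_mul_of_nonneg_left hε64 hC₁
    linarith
  obtain ⟨z, hz, hzmax⟩ := hu.exists_isMaxOn hΩ hΩb hxsΩ (hXpos.trans_le hlow)
  refine ⟨u z, ⟨⟨z, hz, rfl⟩, by rintro _ ⟨y, hy, rfl⟩; exact hzmax y hy⟩, ?_⟩
  -- Near `xbar` the profile decides; farther away the gap in `H` does.
  have hup : u z ≤ X + (C₁ + C₂) * ε ^ 6 := by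
    by_cases hzr : dist (base z) xbar ≤ r / 2
    · have h1 := (abs_le.1 (happrox ε hε hε1 u hu z hz hzr)).2
      have hzb : base z ∈ Metric.ball xbar R := by
        rw [Metric.mem_ball]; linarith
      have h2 := (hRball _ hzb).1 ε hε (by linarith) z hz rfl
      rw [← hX'] at h2
      linarith
    · have h1 := hgap _ hz.1 (not_le.1 hzr).le
      rw [hH] at h1
      have h2 := haway ε hε u hu z hz h1
      have h3 := mul_lt_mul_of_pos_left s3 hε2
      have h4 := mul_le_mul_of_nonneg_left hε64 hK
      have h5 : -(ε ^ 4 * (H₀ ^ 2 / 4) * |γ₀|) ≤ ε ^ 4 * (H₀ ^ 2 / 4) * γ₀ := by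
        rw [← mul_neg]
        exact mul_le_mul_of_nonneg_left (neg_abs_le _) (by positivity)
      have h6 : 0 ≤ (C₁ + C₂) * ε ^ 6 := by positivity
      rw [hX']
      rw [hg] at h3
      linarith
  have h1 := hlow.trans (hzmax xs hxsΩ)
  have h2 := mul_le_mul_of_nonneg_left hε65 hC₁
  have h3 := mul_le_mul_of_nonneg_left hε65 hC₂
  have h4 : 0 < ε ^ 5 := by positivity
  have h5 : 0 ≤ C₁ * ε ^ 5 := by positivity
  have h6 : 0 ≤ C₂ * ε ^ 5 := by positivity
  rw [abs_le]
  constructor <;> linarith
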